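/- Let $\beta\in(3/2,2)$, and let $L^2(0,1)$ be the space of complex-valued square-integrable functions with inner product $(f,g)=\int_0^1 f\bar g\,dx$. Let $\widetilde H^{\beta/2}(0,1)$ $(=H_0^{\beta/2}(0,1))$ be the space of those $u\in L^2(0,1)$ whose extension by zero belongs to $H^{\beta/2}(\mathbb R)$. For $0<s<1$ denote by $${}_0D_x^{s}u=\frac{1}{\Gamma(1-s)}\frac{d}{dx}\int_0^x (x-t)^{-s}u(t)\,dt,\qquad {}_xD_1^{s}u=\frac{-1}{\Gamma(1-s)}\frac{d}{dx}\int_x^1 (t-x)^{-s}u(t)\,dt$$ the left- and right-sided Riemann--Liouville derivatives on $(0,1)$, where $d/dx$ is the weak derivative. Then ${}_0D_x^{\beta/2}\varphi$ and ${}_xD_1^{\beta/2}\varphi$ exist and lie in $L^2(0,1)$ for every $\varphi\in\widetilde H^{\beta/2}(0,1)$, so that $$A(\varphi,\psi)=-\bigl({}_0D_x^{\beta/2}\varphi,\ {}_xD_1^{\beta/2}\psi\bigr),\qquad \varphi,\psi\in\widetilde H^{\beta/2}(0,1),$$ is a well-defined sesquilinear form. Let $A$ be the operator in $L^2(0,1)$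 induced by it: $D(A)$ is the set of all $\varphi\in\widetilde H^{\beta/2}(0,1)$ for which there is an $f\in L^2(0,1)$ with $A(\varphi,\psi)=(f,\psi)$ for all $\psi\in\widetilde H^{\beta/2}(0,1)$, and then $A\varphi=f$. For every $\theta\in\bigl((2-\beta)\pi/2,\ \pi/4\bigr)$ the resolvent set $\rho(A)$, i.e. the set of all $z\in\mathbb C$ for which $zI-A:D(A)\to L^2(0,1)$ is bijective with bounded inverse, contains the sector $$\{z\in\mathbb C\setminus\{0\}:\ \theta\le|\arg z|\le\pi\},\qquad \arg z\in(-\pi,\pi].$$ -/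

import Mathlib

open MeasureTheory Set
open scoped SchwartzMap ContDiff InnerProductSpace

noncomputable section

namespace FracOp

/-- The complex Hilbert space `L²(0,1)`. -/
abbrev L2I : Type := Lp ℂ 2 (volume.restrict (Ioo (0 : ℝ) 1))

theorem memLp_zeroExt (u : L2I) :
    MemLp ((Ioo (0 : ℝ) 1).indicator (u : ℝ → ℂ)) 2 (volume : Measure ℝ) :=
  (memLp_indicator_iff_restrict measurableSet_Ioo).2 (Lp.memLp u)

/-- Extension by zero, `L²(0,1) → L²(ℝ)`. -/
def zeroExt : L2I →ₗ[ℂ] Lp ℂ 2 (volume : Measure ℝ) where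
  toFun u := (memLp_zeroExt u).toLp _
  map_add' u v := by
    rw [← MemLp.toLp_add]
    apply MemLp.toLp_congr
    have h := (ae_restrict_iff' measurableSet_Ioo).1 (Lp.coeFn_add u v)
    filter_upwards [h] with x hx
    by_cases hm : x ∈ Ioo (0 : ℝ) 1
    · simp only [indicator_of_mem hm, Pi.add_apply, hx hm]
    · simp only [indicator_of_notMem hm, Pi.add_apply, add_zero]
  map_smul' c u := by
    rw [RingHom.id_apply, ← MemLp.toLp_const_smul]
    apply MemLp.toLp_congr
    have h := (ae_restrict_iff' measurableSet_Ioo).1 (Lp.coeFn_smul c u)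
    filter_upwards [h] with x hx
    by_cases hm : x ∈ Ioo (0 : ℝ) 1
    · simp only [indicator_of_mem hm, Pi.smul_apply, hx hm]
    · simp only [indicator_of_notMem hm, Pi.smul_apply, smul_zero]

/-- The space `H̃ˢ(0,1)` of all `u ∈ L²(0,1)` whose extension by zero belongs to `Hˢ(ℝ)`. -/
def Htilde (s : ℝ) : Submodule ℂ L2I where
  carrier := {u | TemperedDistribution.MemSobolev s 2 (zeroExt u : 𝓢'(ℝ, ℂ))}
  zero_mem' := by
    simp only [mem_ofPred_eq, map_zero]
    rw [← Lp.toTemperedDistributionCLM_apply, map_zero]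
    exact TemperedDistribution.memSobolev_fun_zero ℝ ℂ s 2
  add_mem' {u v} hu hv := by
    simp only [mem_ofPred_eq] at hu hv ⊢
    rw [map_add, ← Lp.toTemperedDistributionCLM_apply, map_add]
    exact hu.add hv
  smul_mem' c u hu := by
    simp only [mem_ofPred_eq] at hu ⊢
    rw [map_smul, ← Lp.toTemperedDistributionCLM_apply, map_smul]
    exact hu.smul c

/-- Smooth real test functions with compact support in the open interval `(0,1)`. -/
def IsTest (η : ℝ → ℝ) : Prop :=
  ContDiff ℝ ∞ η ∧ HasCompactSupport η ∧ tsupport η ⊆ Ioo (0 : ℝ) 1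

/-- `g` is the weak (distributional) derivative of `F` on `(0,1)`; both are in `L¹_loc(0,1)`. -/
structure HasWeakDeriv (F g : ℝ → ℂ) : Prop where
  locInt : LocallyIntegrableOn F (Ioo (0 : ℝ) 1)
  locInt_deriv : LocallyIntegrableOn g (Ioo (0 : ℝ) 1)
  integral_eq : ∀ η : ℝ → ℝ, IsTest η →
    ∫ x in Ioo (0 : ℝ) 1, deriv η x • F x = -∫ x in Ioo (0 : ℝ) 1, η x • g x

theorem integrableOn_test_smul {χ : ℝ → ℝ} (hχ : Continuous χ) (hc : HasCompactSupport χ)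
    (hs : tsupport χ ⊆ Ioo (0 : ℝ) 1) {F : ℝ → ℂ}
    (hF : LocallyIntegrableOn F (Ioo (0 : ℝ) 1)) :
    IntegrableOn (fun x => χ x • F x) (Ioo (0 : ℝ) 1) := by
  have h1 : IntegrableOn F (tsupport χ) := hF.integrableOn_compact_subset hs hc
  have h2 : IntegrableOn (fun x => χ x • F x) (tsupport χ) :=
    h1.continuousOn_smul hχ.continuousOn hc
  have h3 : Integrable (fun x => χ x • F x) := by
    rw [← integrableOn_univ]
    refine h2.of_forall_sdiff_eq_zero MeasurableSet.univ ?_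
    intro x hx
    rw [image_eq_zero_of_notMem_tsupport hx.2, zero_smul]
  exact h3.integrableOn

theorem IsTest.integrableOn_smul {η : ℝ → ℝ} (hη : IsTest η) {F : ℝ → ℂ}
    (hF : LocallyIntegrableOn F (Ioo (0 : ℝ) 1)) :
    IntegrableOn (fun x => η x • F x) (Ioo (0 : ℝ) 1) :=
  integrableOn_test_smul hη.1.continuous hη.2.1 hη.2.2 hF

theorem IsTest.integrableOn_deriv_smul {η : ℝ → ℝ} (hη : IsTest η) {F : ℝ → ℂ}
    (hF : LocallyIntegrableOn F (Ioo (0 : ℝ) 1)) :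
    IntegrableOn (fun x => deriv η x • F x) (Ioo (0 : ℝ) 1) :=
  integrableOn_test_smul (hη.1.continuous_deriv (by simp)) hη.2.1.deriv
    (fun _ h => hη.2.2 (tsupport_deriv_subset h)) hF

theorem HasWeakDeriv.add {F G f g : ℝ → ℂ} (hF : HasWeakDeriv F f) (hG : HasWeakDeriv G g) :
    HasWeakDeriv (F + G) (f + g) := by
  refine ⟨hF.locInt.add hG.locInt, hF.locInt_deriv.add hG.locInt_deriv, fun η hη => ?_⟩
  simp only [Pi.add_apply, smul_add]
  rw [integral_add (hη.integrableOn_deriv_smul hF.locInt) (hη.integrableOn_deriv_smul hG.locInt),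
    integral_add (hη.integrableOn_smul hF.locInt_deriv) (hη.integrableOn_smul hG.locInt_deriv),
    hF.integral_eq η hη, hG.integral_eq η hη, neg_add]

theorem HasWeakDeriv.const_smul {F f : ℝ → ℂ} (hF : HasWeakDeriv F f) (c : ℂ) :
    HasWeakDeriv (c • F) (c • f) := by
  refine ⟨hF.locInt.smul c, hF.locInt_deriv.smul c, fun η hη => ?_⟩
  simp only [Pi.smul_apply, smul_comm _ c]
  rw [integral_smul, integral_smul, hF.integral_eq η hη, smul_neg]

theorem HasWeakDeriv.congr {F G f g : ℝ → ℂ} (hF : HasWeakDeriv F f)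
    (h : F =ᵐ[volume.restrict (Ioo (0 : ℝ) 1)] G) (h' : f =ᵐ[volume.restrict (Ioo (0 : ℝ) 1)] g) :
    HasWeakDeriv G g := by
  refine ⟨hF.locInt.congr h, hF.locInt_deriv.congr h', fun η hη => ?_⟩
  rw [← integral_congr_ae (h.mono fun x hx => by simp only [hx] :
      (fun x => deriv η x • F x) =ᵐ[_] fun x => deriv η x • G x), hF.integral_eq η hη,
    integral_congr_ae (h'.mono fun x hx => by simp only [hx] :
      (fun x => η x • f x) =ᵐ[_] fun x => η x • g x)]

theorem locallyIntegrableOn_L2I (u : L2I) : LocallyIntegrableOn u (Ioo (0 : ℝ) 1) :=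
  IntegrableOn.locallyIntegrableOn ((Lp.memLp u).integrable (by norm_num))

/-- The weak derivative is unique. -/
theorem HasWeakDeriv.eq_zero {F g : ℝ → ℂ} (h : HasWeakDeriv F g)
    (hF : F =ᵐ[volume.restrict (Ioo (0 : ℝ) 1)] 0) : g =ᵐ[volume.restrict (Ioo (0 : ℝ) 1)] 0 := by
  have h0 : HasWeakDeriv 0 g := h.congr hF (Filter.EventuallyEq.refl _ _)
  refine (ae_restrict_iff' measurableSet_Ioo).2 ?_
  refine isOpen_Ioo.ae_eq_zero_of_integral_contDiff_smul_eq_zero h0.locInt_deriv ?_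
  intro η h1 h2 h3
  have h4 := h0.integral_eq η ⟨h1, h2, h3⟩
  simp only [Pi.zero_apply, smul_zero, integral_zero, zero_eq_neg] at h4
  rw [← h4, setIntegral_eq_integral_of_forall_compl_eq_zero]
  intro x hx
  rw [image_eq_zero_of_notMem_tsupport (fun h => hx (h3 h)), zero_smul]

/-- The pairs `(u, g)` in `L²(0,1) × L²(0,1)` such that `g` is the weak derivative on `(0,1)` of
`x ↦ c * ∫_{J x} k x t * u t dt`, the integral being absolutely convergent for almost every `x`. -/
def weakDerivIntegralGraph (c : ℝ) (J : ℝ → Set ℝ)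
    (hJ : ∀ x ∈ Ioo (0 : ℝ) 1, J x ⊆ Ioo (0 : ℝ) 1) (k : ℝ → ℝ → ℝ) :
    Submodule ℂ (L2I × L2I) where
  carrier := {p |
    (∀ᵐ x ∂(volume.restrict (Ioo (0 : ℝ) 1)),
      IntegrableOn (fun t => k x t • (p.1 : ℝ → ℂ) t) (J x)) ∧
    HasWeakDeriv (fun x => c • ∫ t in J x, k x t • (p.1 : ℝ → ℂ) t) p.2}
  zero_mem' := by
    have hz : ∀ x ∈ Ioo (0 : ℝ) 1, (fun t => k x t • ((0 : L2I) : ℝ → ℂ) t)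
        =ᵐ[volume.restrict (J x)] fun _ => 0 := fun x hx =>
      (ae_restrict_of_ae_restrict_of_subset (hJ x hx)
        (Lp.coeFn_zero ℂ 2 (volume.restrict (Ioo (0 : ℝ) 1)))).mono fun t ht => by
        simp only [ht, Pi.zero_apply, smul_zero]
    refine ⟨(ae_restrict_iff' measurableSet_Ioo).2 (.of_forall fun x hx =>
      (integrable_zero _ _ _).congr (hz x hx).symm), ?_⟩
    have h0 : HasWeakDeriv 0 0 := ⟨integrableOn_zero.locallyIntegrableOn,
      integrableOn_zero.locallyIntegrableOn, by simp⟩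
    refine h0.congr ?_ (Lp.coeFn_zero ℂ 2 (volume.restrict (Ioo (0 : ℝ) 1))).symm
    refine (ae_restrict_iff' measurableSet_Ioo).2 (.of_forall fun x hx => ?_)
    simp only [Prod.fst_zero]
    rw [integral_congr_ae (hz x hx)]
    simp
  add_mem' {p q} hp hq := by
    have hz : ∀ x ∈ Ioo (0 : ℝ) 1, (fun t => k x t • ((p.1 + q.1 : L2I) : ℝ → ℂ) t)
        =ᵐ[volume.restrict (J x)]
          fun t => k x t • (p.1 : ℝ → ℂ) t + k x t • (q.1 : ℝ → ℂ) t := fun x hx =>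
      (ae_restrict_of_ae_restrict_of_subset (hJ x hx) (Lp.coeFn_add p.1 q.1)).mono
        fun t ht => by simp only [ht, Pi.add_apply, smul_add]
    have hm : ∀ᵐ x ∂(volume.restrict (Ioo (0 : ℝ) 1)), x ∈ Ioo (0 : ℝ) 1 :=
      ae_restrict_mem measurableSet_Ioo
    refine ⟨?_, ?_⟩
    · filter_upwards [hm, hp.1, hq.1] with x hx h1 h2
      exact (h1.add h2).congr (hz x hx).symm
    · refine (hp.2.add hq.2).congr ?_ (Lp.coeFn_add p.2 q.2).symm
      filter_upwards [hm, hp.1, hq.1] with x hx h1 h2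
      simp only [Pi.add_apply, Prod.fst_add]
      rw [integral_congr_ae (hz x hx), integral_add h1 h2, smul_add]
  smul_mem' a p hp := by
    have hz : ∀ x ∈ Ioo (0 : ℝ) 1, (fun t => k x t • ((a • p.1 : L2I) : ℝ → ℂ) t)
        =ᵐ[volume.restrict (J x)] fun t => a • (k x t • (p.1 : ℝ → ℂ) t) := fun x hx =>
      (ae_restrict_of_ae_restrict_of_subset (hJ x hx) (Lp.coeFn_smul a p.1)).mono
        fun t ht => by simp only [ht, Pi.smul_apply, smul_comm a]
    have hm : ∀ᵐ x ∂(volume.restrict (Ioo (0 : ℝ) 1)), x ∈ Ioo (0 : ℝ) 1 :=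
      ae_restrict_mem measurableSet_Ioo
    refine ⟨?_, ?_⟩
    · filter_upwards [hm, hp.1] with x hx h1
      exact (h1.smul a).congr (hz x hx).symm
    · refine (hp.2.const_smul a).congr ?_ (Lp.coeFn_smul a p.2).symm
      filter_upwards [hm] with x hx
      simp only [Pi.smul_apply, Prod.smul_fst]
      rw [integral_congr_ae (hz x hx), integral_smul, smul_comm]

/-- Such a `g` is determined by `u`. -/
theorem weakDerivIntegralGraph_snd_eq_zero (c : ℝ) (J : ℝ → Set ℝ)
    (hJ : ∀ x ∈ Ioo (0 : ℝ) 1, J x ⊆ Ioo (0 : ℝ) 1) (k : ℝ → ℝ → ℝ) (p : L2I × L2I)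
    (hp : p ∈ weakDerivIntegralGraph c J hJ k) (h0 : p.1 = 0) : p.2 = 0 := by
  refine (Lp.eq_zero_iff_ae_eq_zero).2 (hp.2.eq_zero ?_)
  refine (ae_restrict_iff' measurableSet_Ioo).2 (.of_forall fun x hx => ?_)
  have hz : (fun t => k x t • (p.1 : ℝ → ℂ) t) =ᵐ[volume.restrict (J x)] fun _ => 0 := by
    rw [h0]
    exact (ae_restrict_of_ae_restrict_of_subset (hJ x hx)
      (Lp.coeFn_zero ℂ 2 (volume.restrict (Ioo (0 : ℝ) 1)))).mono fun t ht => by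
        simp only [ht, Pi.zero_apply, smul_zero]
  simp only [Pi.zero_apply]
  rw [integral_congr_ae hz]
  simp

/-- The left-sided Riemann–Liouville derivative of order `s ∈ (0,1)` on `(0,1)`,
`u ↦ (1 / Γ(1-s)) d/dx ∫₀ˣ (x-t)^(-s) u(t) dt`, as an unbounded operator in `L²(0,1)`;
`d/dx` is the weak derivative, and the domain consists of all `u` for which it is in `L²(0,1)`. -/
def leftRL (s : ℝ) : L2I →ₗ.[ℂ] L2I :=
  (weakDerivIntegralGraph (1 / Real.Gamma (1 - s)) (fun x => Ioo 0 x)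
    (fun _ hx => Ioo_subset_Ioo_right hx.2.le) (fun x t => (x - t) ^ (-s))).toLinearPMap

/-- The right-sided Riemann–Liouville derivative of order `s ∈ (0,1)` on `(0,1)`,
`u ↦ (-1 / Γ(1-s)) d/dx ∫ₓ¹ (t-x)^(-s) u(t) dt`, as an unbounded operator in `L²(0,1)`. -/
def rightRL (s : ℝ) : L2I →ₗ.[ℂ] L2I :=
  (weakDerivIntegralGraph (-1 / Real.Gamma (1 - s)) (fun x => Ioo x 1)
    (fun _ hx => Ioo_subset_Ioo_left hx.1.le) (fun x t => (t - x) ^ (-s))).toLinearPMap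

/-- Check of the definition: membership in the graph of `leftRL`. -/
theorem mem_graph_leftRL (s : ℝ) (u g : L2I) : (u, g) ∈ (leftRL s).graph ↔
    (∀ᵐ x ∂(volume.restrict (Ioo (0 : ℝ) 1)),
      IntegrableOn (fun t => (x - t) ^ (-s) • (u : ℝ → ℂ) t) (Ioo 0 x)) ∧
    HasWeakDeriv (fun x => (1 / Real.Gamma (1 - s)) • ∫ t in Ioo 0 x,
      (x - t) ^ (-s) • (u : ℝ → ℂ) t) g := by
  rw [leftRL, Submodule.toLinearPMap_graph_eq _ (weakDerivIntegralGraph_snd_eq_zero _ _ _ _)]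
  rfl

/-- Check of the definition: membership in the graph of `rightRL`. -/
theorem mem_graph_rightRL (s : ℝ) (u g : L2I) : (u, g) ∈ (rightRL s).graph ↔
    (∀ᵐ x ∂(volume.restrict (Ioo (0 : ℝ) 1)),
      IntegrableOn (fun t => (t - x) ^ (-s) • (u : ℝ → ℂ) t) (Ioo x 1)) ∧
    HasWeakDeriv (fun x => (-1 / Real.Gamma (1 - s)) • ∫ t in Ioo x 1,
      (t - x) ^ (-s) • (u : ℝ → ℂ) t) g := by
  rw [rightRL, Submodule.toLinearPMap_graph_eq _ (weakDerivIntegralGraph_snd_eq_zero _ _ _ _)]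
  rfl

/-- The sesquilinear form `A(φ, ψ) = -(D_left^{β/2} φ, D_right^{β/2} ψ)` on `H̃^{β/2}(0,1)`, where
`(f, g) = ∫ f ḡ`. (Mathlib's `inner ℂ g f` is conjugate-linear in `g`, so it is `∫ f ḡ`.)
The arguments `hL`, `hR` say that both derivatives are defined on all of `H̃^{β/2}(0,1)`. -/
def form (β : ℝ) (hL : Htilde (β / 2) ≤ (leftRL (β / 2)).domain)
    (hR : Htilde (β / 2) ≤ (rightRL (β / 2)).domain) (φ ψ : Htilde (β / 2)) : ℂ :=
  -inner ℂ (rightRL (β / 2) ⟨ψ, hR ψ.2⟩) (leftRL (β / 2) ⟨φ, hL φ.2⟩)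

/-- The functional `A(φ, ·)` on `H̃^{β/2}(0,1)` is given by `f ∈ L²(0,1)`:
`A(φ, ψ) = (f, ψ)` for all `ψ ∈ H̃^{β/2}(0,1)`. -/
def Represents (β : ℝ) (hL : Htilde (β / 2) ≤ (leftRL (β / 2)).domain)
    (hR : Htilde (β / 2) ≤ (rightRL (β / 2)).domain) (φ : Htilde (β / 2)) (f : L2I) : Prop :=
  ∀ ψ : Htilde (β / 2), form β hL hR φ ψ = inner ℂ (ψ : L2I) f

section

variable {β : ℝ} {hL : Htilde (β / 2) ≤ (leftRL (β / 2)).domain}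
  {hR : Htilde (β / 2) ≤ (rightRL (β / 2)).domain}

theorem form_add_left (φ φ' ψ : Htilde (β / 2)) :
    form β hL hR (φ + φ') ψ = form β hL hR φ ψ + form β hL hR φ' ψ := by
  simp only [form]
  rw [← neg_add, ← inner_add_right, ← LinearPMap.map_add]
  rfl

theorem form_smul_left (a : ℂ) (φ ψ : Htilde (β / 2)) :
    form β hL hR (a • φ) ψ = a * form β hL hR φ ψ := by
  simp only [form]
  rw [mul_neg, ← inner_smul_right, ← LinearPMap.map_smul]
  rfl

theorem IsTest.memLp {η : ℝ → ℝ} (hη : IsTest η) :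
    MemLp (fun x => (η x : ℂ)) 2 (volume.restrict (Ioo (0 : ℝ) 1)) := by
  have h1 : Continuous fun x => (η x : ℂ) := Complex.continuous_ofReal.comp hη.1.continuous
  have h2 : HasCompactSupport fun x => (η x : ℂ) :=
    hη.2.1.comp_left (g := Complex.ofReal) Complex.ofReal_zero
  exact (h1.memLp_of_hasCompactSupport h2).restrict _

theorem IsTest.toLp_mem_Htilde {η : ℝ → ℝ} (hη : IsTest η) (s : ℝ) :
    hη.memLp.toLp _ ∈ Htilde s := by
  have h1 : ContDiff ℝ ∞ fun x => (η x : ℂ) := Complex.ofRealCLM.contDiff.comp hη.1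
  have h2 : HasCompactSupport fun x => (η x : ℂ) :=
    hη.2.1.comp_left (g := Complex.ofReal) Complex.ofReal_zero
  let S : 𝓢(ℝ, ℂ) := h2.toSchwartzMap h1
  have h3 : zeroExt (hη.memLp.toLp _) = S.toLp 2 := by
    refine Lp.ext ?_
    have h4 := (ae_restrict_iff' measurableSet_Ioo).1 hη.memLp.coeFn_toLp
    filter_upwards [(memLp_zeroExt (hη.memLp.toLp _)).coeFn_toLp, S.coeFn_toLp 2, h4]
      with x hx hS h4
    refine hx.trans (Eq.trans ?_ hS.symm)
    by_cases hm : x ∈ Ioo (0 : ℝ) 1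
    · rw [indicator_of_mem hm, h4 hm]
      rfl
    · rw [indicator_of_notMem hm]
      change 0 = (η x : ℂ)
      rw [image_eq_zero_of_notMem_tsupport (fun h => hm (hη.2.2 h)), Complex.ofReal_zero]
  change TemperedDistribution.MemSobolev s 2 (zeroExt (hη.memLp.toLp _) : 𝓢'(ℝ, ℂ))
  rw [h3, Lp.toTemperedDistribution_toLp_eq]
  exact S.memSobolev

/-- `f` is determined by `φ`, as `H̃^{β/2}(0,1)` is dense in `L²(0,1)`. -/
theorem Represents.eq_zero {f : L2I} (h : Represents β hL hR 0 f) : f = 0 := by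
  have h4 : ∀ ψ ∈ Htilde (β / 2), inner ℂ ψ f = 0 := by
    intro ψ hψ
    have e := form_smul_left (hL := hL) (hR := hR) 0 0 ⟨ψ, hψ⟩
    rw [zero_smul, zero_mul, h ⟨ψ, hψ⟩] at e
    exact e
  refine (Lp.eq_zero_iff_ae_eq_zero).2 ((ae_restrict_iff' measurableSet_Ioo).2 ?_)
  refine isOpen_Ioo.ae_eq_zero_of_integral_contDiff_smul_eq_zero (locallyIntegrableOn_L2I f) ?_
  intro η e1 e2 e3
  have hη : IsTest η := ⟨e1, e2, e3⟩
  have h5 := h4 _ (hη.toLp_mem_Htilde (β / 2))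
  rw [MeasureTheory.L2.inner_def] at h5
  rw [← setIntegral_eq_integral_of_forall_compl_eq_zero (s := Ioo (0 : ℝ) 1)
    (fun x hx => by rw [image_eq_zero_of_notMem_tsupport (fun h => hx (e3 h)), zero_smul]), ← h5]
  refine integral_congr_ae ?_
  filter_upwards [hη.memLp.coeFn_toLp] with x hx
  rw [hx]
  simp [mul_comm]

end

/-- The graph of the operator `A` induced by the form: all pairs `(φ, f)` with
`φ ∈ H̃^{β/2}(0,1)`, `f ∈ L²(0,1)` and `A(φ, ψ) = (f, ψ)` for all `ψ ∈ H̃^{β/2}(0,1)`. -/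
def operatorGraph (β : ℝ) (hL : Htilde (β / 2) ≤ (leftRL (β / 2)).domain)
    (hR : Htilde (β / 2) ≤ (rightRL (β / 2)).domain) : Submodule ℂ (L2I × L2I) where
  carrier := {p | ∃ φ : Htilde (β / 2), (φ : L2I) = p.1 ∧ Represents β hL hR φ p.2}
  zero_mem' := ⟨0, rfl, fun ψ => by
    have e := form_smul_left (hL := hL) (hR := hR) 0 0 ψ
    rw [zero_smul, zero_mul] at e
    rw [e]
    exact (inner_zero_right _).symm⟩
  add_mem' := by
    rintro p q ⟨φ, hp, h⟩ ⟨φ', hq, h'⟩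
    refine ⟨φ + φ', by rw [Submodule.coe_add, hp, hq, Prod.fst_add], fun ψ => ?_⟩
    rw [form_add_left, h ψ, h' ψ, Prod.snd_add, inner_add_right]
  smul_mem' := by
    rintro a p ⟨φ, hp, h⟩
    refine ⟨a • φ, by rw [Submodule.coe_smul, hp, Prod.smul_fst], fun ψ => ?_⟩
    rw [form_smul_left, h ψ, Prod.smul_snd, inner_smul_right]

/-- The operator `A : D(A) → L²(0,1)`, `D(A) ⊆ H̃^{β/2}(0,1) ⊆ L²(0,1)`, induced by the form. -/
def operator (β : ℝ) (hL : Htilde (β / 2) ≤ (leftRL (β / 2)).domain)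
    (hR : Htilde (β / 2) ≤ (rightRL (β / 2)).domain) : L2I →ₗ.[ℂ] L2I :=
  (operatorGraph β hL hR).toLinearPMap

/-- Check of the definition: `operatorGraph` is the graph of `operator`. -/
theorem graph_operator (β : ℝ) (hL : Htilde (β / 2) ≤ (leftRL (β / 2)).domain)
    (hR : Htilde (β / 2) ≤ (rightRL (β / 2)).domain) :
    (operator β hL hR).graph = operatorGraph β hL hR := by
  refine Submodule.toLinearPMap_graph_eq _ ?_
  rintro p ⟨φ, hp, h⟩ h0
  have : φ = 0 := Subtype.ext (hp.trans h0)
  subst this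
  exact h.eq_zero

/-- The resolvent set of an unbounded operator `A` in a complex normed space: all `z` for which
`z - A : D(A) → H` has a bounded inverse, defined on the whole space. -/
def resolventSet {H : Type*} [NormedAddCommGroup H] [NormedSpace ℂ H] (A : H →ₗ.[ℂ] H) : Set ℂ :=
  {z | ∃ R : H →L[ℂ] H,
    (∀ f : H, ∃ h : R f ∈ A.domain, z • R f - A ⟨R f, h⟩ = f) ∧
    ∀ u : A.domain, R (z • (u : H) - A u) = u}

end FracOp

end

noncomputable section

namespace FracOp

open Filter Topology FourierTransform

/-! ### The Gamma integral with complex rate -/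

/-! Put `s = β/2` and write `û` for the Fourier transform of the zero extension of `u`. The left and
right Riemann–Liouville derivatives of `u` are the restrictions to `(0,1)` of the functions on `ℝ`
with Fourier transforms `(2πiξ)^s û` and `(-2πiξ)^s û`, which are square integrable when `u ∈ H̃ˢ`
(`mem_graph_leftRL_of_memLp`, `mem_graph_rightRL_of_memLp`). The kernel `y^(-s)` is not integrable
at infinity, so this is shown with an extra factor `e^(-εy)`, tested against smooth functions, and
`ε → 0`.

On `ℝ` the left derivative of `φ` vanishes on `(-∞,0)` and the right derivative of `ψ` on `(1,∞)`.
Their product therefore lives on `(0,1)`, and Plancherel gives `A(φ,ψ) = -∫ (2πiξ)^(2s) φ̂ conj ψ̂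
dξ` (`form_eq`, `star_fracSymbol_neg_one`).

The symbol `-(2πiξ)^(2s)` has values on the two rays `arg = ±(1-s)π = ±(2-β)π/2`. If `|arg z|` is
larger than this angle, some rotation `e` gives `Re e(-(2πiξ)^(2s) - z) ≥ c(1+ξ²)^s` with `c > 0`
(`exists_symbol_coercive`). So the form of `A - z` is coercive on `H̃ˢ` up to a rotation, and a
Lax–Milgram argument (`isUnit_shiftedForm`, `mem_resolventSet_of_isUnit`) yields the bounded
resolvent. The form domain is handled through the weighted transforms `w = (1+ξ²)^(s/2) û`, a closed
subspace of `L²(ℝ)`. -/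

theorem integrableOn_rpow_mul_exp_neg_mul {a b : ℝ} (ha : -1 < a) (hb : 0 < b) :
    IntegrableOn (fun t : ℝ => t ^ a * Real.exp (-(b * t))) (Ioi 0) := by
  simpa using integrableOn_rpow_mul_exp_neg_mul_rpow ha one_pos hb

theorem norm_rpow_mul_cexp {a t : ℝ} (ht : 0 < t) (r : ℂ) :
    ‖((t ^ a : ℝ) : ℂ) * Complex.exp (-(r * t))‖ = t ^ a * Real.exp (-(r.re * t)) := by
  rw [norm_mul, Complex.norm_real, Complex.norm_exp, Real.norm_of_nonneg (by positivity)]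
  simp

theorem aestronglyMeasurable_rpow_mul_cexp (a : ℝ) (r : ℂ) (μ : Measure ℝ) :
    AEStronglyMeasurable (fun t : ℝ => ((t ^ a : ℝ) : ℂ) * Complex.exp (-(r * t))) μ :=
  Measurable.aestronglyMeasurable (by fun_prop)

theorem integrableOn_rpow_mul_cexp_neg_mul {a : ℝ} (ha : -1 < a) {r : ℂ} (hr : 0 < r.re) :
    IntegrableOn (fun t : ℝ => ((t ^ a : ℝ) : ℂ) * Complex.exp (-(r * t))) (Ioi 0) := by
  refine (integrableOn_rpow_mul_exp_neg_mul ha hr).mono'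
    (aestronglyMeasurable_rpow_mul_cexp a r _) ?_
  filter_upwards [ae_restrict_mem measurableSet_Ioi] with t ht
  exact (norm_rpow_mul_cexp ht r).le

theorem differentiableAt_integral_rpow_mul_cexp {a : ℝ} (ha : -1 < a) {r : ℂ} (hr : 0 < r.re) :
    DifferentiableAt ℂ (fun r : ℂ => ∫ t in Ioi (0 : ℝ),
      ((t ^ a : ℝ) : ℂ) * Complex.exp (-(r * t))) r := by
  -- Halving `r.re` leaves a neighbourhood of `r` on which one integrable bound serves all `z`.
  have hs : {z : ℂ | r.re / 2 < z.re} ∈ 𝓝 r :=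
    (isOpen_lt continuous_const Complex.continuous_re).mem_nhds (by simp; linarith)
  refine (hasDerivAt_integral_of_dominated_loc_of_deriv_le (𝕜 := ℂ)
    (F' := fun z t => ((t ^ a : ℝ) : ℂ) * (Complex.exp (-(z * t)) * (-(t : ℂ))))
    (bound := fun t : ℝ => t ^ (a + 1) * Real.exp (-(r.re / 2 * t))) hs
    (.of_forall fun z => aestronglyMeasurable_rpow_mul_cexp a z _)
    (integrableOn_rpow_mul_cexp_neg_mul ha hr) (Measurable.aestronglyMeasurable (by fun_prop))
    ?_ (integrableOn_rpow_mul_exp_neg_mul (by linarith) (by linarith)) ?_).2.differentiableAt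
  · filter_upwards [ae_restrict_mem measurableSet_Ioi] with t ht z hz
    have ht' : 0 < t := ht
    rw [← mul_assoc, norm_mul, norm_rpow_mul_cexp ht, norm_neg, Complex.norm_real,
      Real.norm_of_nonneg ht'.le, Real.rpow_add ht', Real.rpow_one]
    have hz' : r.re / 2 < z.re := hz
    calc t ^ a * Real.exp (-(z.re * t)) * t ≤ t ^ a * Real.exp (-(r.re / 2 * t)) * t := by
          gcongr
      _ = _ := by ring
  · refine .of_forall fun t z _ => ?_
    have h1 : HasDerivAt (fun z : ℂ => -(z * t)) (-(t : ℂ)) z := by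
      have h := ((hasDerivAt_id' z).mul_const (t : ℂ)).fun_neg
      rwa [one_mul] at h
    exact h1.cexp.const_mul _

/-- `∫₀^∞ t^(a-1) e^(-rt) dt = Γ(a) r^(-a)` for complex `r` with positive real part. -/
theorem integral_rpow_mul_cexp_neg_mul_Ioi {a : ℝ} (ha : 0 < a) {r : ℂ} (hr : 0 < r.re) :
    ∫ t in Ioi (0 : ℝ), ((t ^ (a - 1) : ℝ) : ℂ) * Complex.exp (-(r * t)) =
      Real.Gamma a * r ^ (-a : ℂ) := by
  have hU : IsOpen {z : ℂ | 0 < z.re} := isOpen_lt continuous_const Complex.continuous_re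
  have hc : IsPreconnected {z : ℂ | 0 < z.re} := (convex_halfSpace_re_gt 0).isPreconnected
  have h1 : AnalyticOnNhd ℂ (fun r : ℂ => ∫ t in Ioi (0 : ℝ),
      ((t ^ (a - 1) : ℝ) : ℂ) * Complex.exp (-(r * t))) {z : ℂ | 0 < z.re} :=
    DifferentiableOn.analyticOnNhd (fun z hz =>
      (differentiableAt_integral_rpow_mul_cexp (by linarith) hz).differentiableWithinAt) hU
  have h2 : AnalyticOnNhd ℂ (fun r : ℂ => Real.Gamma a * r ^ (-a : ℂ)) {z : ℂ | 0 < z.re} := by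
    refine DifferentiableOn.analyticOnNhd (fun z hz => DifferentiableAt.differentiableWithinAt ?_) hU
    exact (differentiableAt_id.cpow_const (Or.inl hz)).const_mul _
  -- Identity theorem: the real Gamma integral gives equality on the positive reals, which
  -- accumulate at `1`.
  refine h1.eqOn_of_preconnected_of_frequently_eq h2 hc (z₀ := 1) (by simp) ?_ hr
  have h3 : ∀ x : ℝ, 0 < x → ∫ t in Ioi (0 : ℝ),
      ((t ^ (a - 1) : ℝ) : ℂ) * Complex.exp (-(x * t)) = Real.Gamma a * (x : ℂ) ^ (-a : ℂ) := by
    intro x hx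
    have h := Complex.integral_cpow_mul_exp_neg_mul_Ioi (a := a) (r := x) (by simpa) hx
    rw [Complex.Gamma_ofReal, one_div, Complex.inv_cpow _ _ (by
      rw [Complex.arg_ofReal_of_nonneg hx.le]; exact Real.pi_pos.ne), ← Complex.cpow_neg,
      mul_comm] at h
    rw [← h]
    refine setIntegral_congr_fun measurableSet_Ioi fun t ht => ?_
    rw [Complex.ofReal_cpow (le_of_lt ht)]
    push_cast
    rfl
  have h4 : Tendsto (fun x : ℝ => (x : ℂ)) (𝓝[≠] 1) (𝓝[≠] 1) := by
    refine tendsto_nhdsWithin_iff.2 ⟨?_, ?_⟩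
    · exact (Complex.continuous_ofReal.tendsto' 1 1 (by simp)).mono_left nhdsWithin_le_nhds
    · filter_upwards [self_mem_nhdsWithin] with x hx
      simpa using hx
  refine h4.frequently (Eventually.frequently ?_)
  filter_upwards [nhdsWithin_le_nhds (lt_mem_nhds one_pos)] with x hx
  exact h3 x hx

/-! ### The regularised kernel -/

/-- `σ / Γ(1-s) (σ y)^(-s) e^(-ε σ y)` for `σ y > 0`, where `σ = ±1`. -/
def kern (s σ ε y : ℝ) : ℝ :=
  (Ioi (0 : ℝ)).indicator
    (fun z => σ * (1 / Real.Gamma (1 - s)) * (z ^ (-s) * Real.exp (-(ε * z)))) (σ * y)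

theorem measurable_kern (s σ ε : ℝ) : Measurable (kern s σ ε) := by
  unfold kern
  exact (Measurable.indicator (by fun_prop) measurableSet_Ioi).comp (measurable_const_mul σ)

theorem integrable_comp_sign_mul {σ : ℝ} (hσ : σ = 1 ∨ σ = -1) {f : ℝ → ℂ} (hf : Integrable f) :
    Integrable fun y => f (σ * y) := by
  rcases hσ with rfl | rfl
  · simpa using hf
  · simpa using hf.comp_neg

theorem integral_comp_sign_mul {σ : ℝ} (hσ : σ = 1 ∨ σ = -1) (f : ℝ → ℂ) :
    ∫ y, f (σ * y) = ∫ y, f y := by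
  rcases hσ with rfl | rfl
  · simp
  · simpa using integral_neg_eq_self f volume

theorem integrable_kern {s σ ε : ℝ} (hs : s < 1) (hσ : σ = 1 ∨ σ = -1) (hε : 0 < ε) :
    Integrable fun y => (kern s σ ε y : ℂ) := by
  have h : Integrable ((Ioi (0 : ℝ)).indicator
    (fun z => σ * (1 / Real.Gamma (1 - s)) * (z ^ (-s) * Real.exp (-(ε * z))))) :=
    IntegrableOn.integrable_indicator
      ((integrableOn_rpow_mul_exp_neg_mul (a := -s) (by linarith) hε).const_mul _) measurableSet_Ioi
  exact integrable_comp_sign_mul hσ h.ofReal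

/-- The Gamma integral with exponent `1 - s` and rate `ε + 2πiσξ`. The factor `σ` combines with the
`2πiξ` of a later derivative to `2πiσξ`, so both one-sided derivatives get the symbol `(2πiσξ)^s`
without a sign. -/
theorem fourier_kern {s σ ε : ℝ} (hs : s < 1) (hσ : σ = 1 ∨ σ = -1) (hε : 0 < ε) (ξ : ℝ) :
    𝓕 (fun y => (kern s σ ε y : ℂ)) ξ =
      σ * ((ε : ℂ) + 2 * Real.pi * Complex.I * (σ * ξ : ℝ)) ^ (s - 1 : ℂ) := by
  have hσ2 : σ * σ = 1 := by rcases hσ with rfl | rfl <;> norm_num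
  rw [Real.fourier_real_eq_integral_exp_smul]
  have h1 : ∀ y : ℝ, Complex.exp (((-2 * Real.pi * y * ξ : ℝ) : ℂ) * Complex.I) •
      (kern s σ ε y : ℂ) = (fun z : ℝ => (Ioi (0 : ℝ)).indicator (fun z : ℝ =>
        (σ * (1 / Real.Gamma (1 - s)) : ℂ) * (((z ^ ((1 - s) - 1) : ℝ) : ℂ) *
        Complex.exp (-(((ε : ℂ) + 2 * Real.pi * Complex.I * (σ * ξ : ℝ)) * z)))) z) (σ * y) := by
    intro y
    simp only [kern]
    by_cases hy : σ * y ∈ Ioi (0 : ℝ)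
    · rw [indicator_of_mem hy, indicator_of_mem hy, smul_eq_mul]
      push_cast
      rw [show (1 - s - 1) = -s by ring, mul_left_comm, mul_left_comm (Complex.exp _),
        ← Complex.exp_add]
      congr 4
      have hσ3 : (σ * σ : ℂ) = 1 := by exact_mod_cast hσ2
      linear_combination (2 * Real.pi * y * ξ * Complex.I) * hσ3
    · rw [indicator_of_notMem hy, indicator_of_notMem hy]
      simp
  simp_rw [h1]
  rw [integral_comp_sign_mul hσ, integral_indicator measurableSet_Ioi, integral_const_mul,
    integral_rpow_mul_cexp_neg_mul_Ioi (by linarith) (by simpa using hε)]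
  have h2 : (Real.Gamma (1 - s) : ℂ) ≠ 0 :=
    Complex.ofReal_ne_zero.2 (Real.Gamma_pos_of_pos (by linarith)).ne'
  rw [show (-((1 - s : ℝ) : ℂ)) = (s - 1 : ℂ) by push_cast; ring]
  field_simp

/-! ### Test functions and the Fourier transform -/

/-- A smooth compactly supported real function as a complex Schwartz function. -/
def testSchwartz {η : ℝ → ℝ} (h1 : ContDiff ℝ ∞ η) (h2 : HasCompactSupport η) : 𝓢(ℝ, ℂ) :=
  (h2.comp_left (g := Complex.ofReal) Complex.ofReal_zero).toSchwartzMap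
    (Complex.ofRealCLM.contDiff.comp h1)

@[simp]
theorem testSchwartz_apply {η : ℝ → ℝ} (h1 : ContDiff ℝ ∞ η) (h2 : HasCompactSupport η) (x : ℝ) :
    testSchwartz h1 h2 x = η x := rfl

theorem fourierInv_testSchwartz_deriv {η : ℝ → ℝ} (h1 : ContDiff ℝ ∞ η)
    (h2 : HasCompactSupport η) (ξ : ℝ) :
    𝓕⁻ (testSchwartz (contDiff_infty_iff_deriv.1 h1).2 h2.deriv) ξ =
      -(2 * Real.pi * Complex.I * ξ) * 𝓕⁻ (testSchwartz h1 h2) ξ := by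
  have hd : deriv (testSchwartz h1 h2) = testSchwartz (contDiff_infty_iff_deriv.1 h1).2 h2.deriv := by
    ext x
    exact ((h1.differentiable (by simp)) x).hasDerivAt.ofReal_comp.deriv
  have hD : Differentiable ℝ (testSchwartz h1 h2) := (testSchwartz h1 h2).differentiable
  have h := congrFun (Real.fourier_deriv (testSchwartz h1 h2).integrable hD
    (by rw [hd]; exact SchwartzMap.integrable _)) (-ξ)
  rw [hd] at h
  rw [SchwartzMap.fourierInv_coe, SchwartzMap.fourierInv_coe, Real.fourierInv_eq_fourier_neg,
    Real.fourierInv_eq_fourier_neg, h, smul_eq_mul]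
  push_cast
  ring

theorem integral_fourier_smul_eq {f g : ℝ → ℂ} (hf : Integrable f) (hg : Integrable g) :
    ∫ ξ, 𝓕 f ξ • g ξ = ∫ x, f x • 𝓕 g x := by
  have h := VectorFourier.integral_fourierIntegral_smul_eq_flip (L := innerₗ ℝ)
    Real.continuous_fourierChar continuous_inner hf hg
  rwa [flip_innerₗ] at h

theorem integral_smul_fourierInv_toLp (φ : 𝓢(ℝ, ℂ)) (w : Lp ℂ 2 (volume : Measure ℝ)) :
    ∫ x, φ x • (𝓕⁻ w : Lp ℂ 2 (volume : Measure ℝ)) x = ∫ ξ, 𝓕⁻ φ ξ • w ξ := by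
  have h := DFunLike.congr_fun (Lp.fourierInv_toTemperedDistribution_eq w) φ
  rw [TemperedDistribution.fourierInv_apply, Lp.toTemperedDistribution_apply,
    Lp.toTemperedDistribution_apply] at h
  exact h.symm

theorem integral_smul_fourier_toLp (φ : 𝓢(ℝ, ℂ)) (w : Lp ℂ 2 (volume : Measure ℝ)) :
    ∫ x, φ x • (𝓕 w : Lp ℂ 2 (volume : Measure ℝ)) x = ∫ ξ, 𝓕 φ ξ • w ξ := by
  have h := DFunLike.congr_fun (Lp.fourier_toTemperedDistribution_eq w) φ
  rw [TemperedDistribution.fourier_apply, Lp.toTemperedDistribution_apply,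
    Lp.toTemperedDistribution_apply] at h
  exact h.symm

theorem continuous_fourier_of_integrable {U : ℝ → ℂ} (h : Integrable U) : Continuous (𝓕 U) :=
  VectorFourier.fourierIntegral_continuous Real.continuous_fourierChar continuous_inner h

/-- On `L¹ ∩ L²` the integral Fourier transform agrees with the one on `L²`. -/
theorem fourier_ae_eq_fourier_toLp {U : ℝ → ℂ} (h1 : Integrable U) (h2 : MemLp U 2) :
    𝓕 U =ᵐ[volume] (𝓕 (h2.toLp U) : Lp ℂ 2 (volume : Measure ℝ)) := by
  refine ae_eq_of_integral_contDiff_smul_eq (continuous_fourier_of_integrable h1).locallyIntegrable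
    ((Lp.memLp _).locallyIntegrable (by norm_num)) fun η e1 e2 => ?_
  have h := integral_smul_fourier_toLp (testSchwartz e1 e2) (h2.toLp U)
  have h' : ∫ ξ, 𝓕 (testSchwartz e1 e2) ξ • (h2.toLp U) ξ = ∫ ξ, 𝓕 (testSchwartz e1 e2) ξ • U ξ :=
    integral_congr_ae (h2.coeFn_toLp.mono fun x hx => by simp only [hx])
  rw [h', SchwartzMap.fourier_coe, integral_fourier_smul_eq (SchwartzMap.integrable _) h1] at h
  simpa using h.symm

/-! ### The regularised fractional integral -/

/-- Convolution of `U` with the kernel `kern s σ ε`. -/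
def fracInt (s σ ε : ℝ) (U : ℝ → ℂ) (x : ℝ) : ℂ := ∫ t, U t * (kern s σ ε (x - t) : ℂ)

theorem fracInt_eq_convolution (s σ ε : ℝ) (U : ℝ → ℂ) :
    fracInt s σ ε U = convolution U (fun y => (kern s σ ε y : ℂ)) (ContinuousLinearMap.mul ℂ ℂ)
      volume := by
  ext x
  rfl

theorem integrable_fracInt {s σ ε : ℝ} (hs : s < 1) (hσ : σ = 1 ∨ σ = -1) (hε : 0 < ε)
    {U : ℝ → ℂ} (hU : Integrable U) : Integrable (fracInt s σ ε U) := by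
  rw [fracInt_eq_convolution]
  exact hU.integrable_convolution _ (integrable_kern hs hσ hε)

theorem fourier_fracInt {s σ ε : ℝ} (hs : s < 1) (hσ : σ = 1 ∨ σ = -1) (hε : 0 < ε)
    {U : ℝ → ℂ} (hU : Integrable U) (ξ : ℝ) : 𝓕 (fracInt s σ ε U) ξ =
      σ * ((ε : ℂ) + 2 * Real.pi * Complex.I * (σ * ξ : ℝ)) ^ (s - 1 : ℂ) * 𝓕 U ξ := by
  rw [fracInt_eq_convolution, Real.fourier_mul_convolution_eq hU (integrable_kern hs hσ hε),
    fourier_kern hs hσ hε, mul_comm]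

/-- Writing `η' = 𝓕 (𝓕⁻ η')` and moving `𝓕` to the other factor turns the derivative into
multiplication, so the convolution is never differentiated itself. -/
theorem integral_deriv_smul_fracInt {s σ ε : ℝ} (hs : s < 1) (hσ : σ = 1 ∨ σ = -1) (hε : 0 < ε)
    {U : ℝ → ℂ} (hU : Integrable U) {η : ℝ → ℝ} (h1 : ContDiff ℝ ∞ η) (h2 : HasCompactSupport η) :
    ∫ x, deriv η x • fracInt s σ ε U x = -∫ ξ, 𝓕⁻ (testSchwartz h1 h2) ξ *
      ((2 * Real.pi * Complex.I * (σ * ξ : ℝ)) *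
        ((ε : ℂ) + 2 * Real.pi * Complex.I * (σ * ξ : ℝ)) ^ (s - 1 : ℂ) * 𝓕 U ξ) := by
  have h := integral_fourier_smul_eq
    (𝓕⁻ (testSchwartz (contDiff_infty_iff_deriv.1 h1).2 h2.deriv)).integrable
    (integrable_fracInt hs hσ hε hU)
  rw [← SchwartzMap.fourier_coe, fourier_fourierInv_eq] at h
  simp only [testSchwartz_apply, fourier_fracInt hs hσ hε hU, smul_eq_mul] at h
  simp only [Complex.real_smul]
  rw [h, ← integral_neg]
  congr 1 with ξ
  rw [fourierInv_testSchwartz_deriv h1 h2 ξ]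
  push_cast
  ring

/-! ### Removal of the regularisation -/

/-- The base has imaginary part `2πσξ`, hence modulus at least `2π|ξ|`, and the exponent `s - 1` is
negative. The bound does not depend on `ε` and serves as majorant for `ε → 0`. -/
theorem norm_symbol_regularised_le {s σ ε : ℝ} (hs : s ∈ Ioo (0 : ℝ) 1) (hσ : σ = 1 ∨ σ = -1)
    (ξ : ℝ) : ‖(2 * Real.pi * Complex.I * (σ * ξ : ℝ)) *
        ((ε : ℂ) + 2 * Real.pi * Complex.I * (σ * ξ : ℝ)) ^ (s - 1 : ℂ)‖ ≤
      (2 * Real.pi * |ξ|) ^ s := by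
  have hz : ‖(2 * Real.pi * Complex.I * (σ * ξ : ℝ) : ℂ)‖ = 2 * Real.pi * |ξ| := by
    have : |σ| = 1 := by rcases hσ with rfl | rfl <;> simp
    simp [this, abs_of_pos Real.pi_pos]
  rcases eq_or_ne ξ 0 with rfl | hξ
  · simp [Real.zero_rpow hs.1.ne']
  have hpos : 0 < 2 * Real.pi * |ξ| := by positivity
  have hle : 2 * Real.pi * |ξ| ≤ ‖(ε : ℂ) + 2 * Real.pi * Complex.I * (σ * ξ : ℝ)‖ := by
    have h := Complex.abs_im_le_norm ((ε : ℂ) + 2 * Real.pi * Complex.I * (σ * ξ : ℝ))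
    have h' := Complex.abs_im_le_norm ((2 * Real.pi * Complex.I * (σ * ξ : ℝ)) : ℂ)
    refine le_trans (le_of_eq ?_) h
    have : |σ| = 1 := by rcases hσ with rfl | rfl <;> simp
    simp [abs_mul, this, abs_of_pos Real.pi_pos]
  rw [norm_mul, hz, show (s - 1 : ℂ) = ((s - 1 : ℝ) : ℂ) by push_cast; ring,
    Complex.norm_cpow_real]
  calc _ ≤ 2 * Real.pi * |ξ| * (2 * Real.pi * |ξ|) ^ (s - 1) := by
        gcongr ?_ * ?_
        exact Real.rpow_le_rpow_of_nonpos hpos hle (by linarith [hs.2])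
    _ = _ := by
        rw [Real.rpow_sub_one hpos.ne']
        field_simp

/-- The symbol `(2πiσξ)^s` of the fractional derivative. -/
def fracSymbol (s σ ξ : ℝ) : ℂ := (2 * Real.pi * Complex.I * (σ * ξ : ℝ)) ^ (s : ℂ)

theorem measurable_fracSymbol (s σ : ℝ) : Measurable (fracSymbol s σ) := by
  unfold fracSymbol
  fun_prop

theorem tendsto_symbol_regularised {s σ : ℝ} (hs : s ∈ Ioo (0 : ℝ) 1) (hσ : σ = 1 ∨ σ = -1)
    (ξ : ℝ) : Tendsto (fun ε : ℝ => (2 * Real.pi * Complex.I * (σ * ξ : ℝ)) *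
        ((ε : ℂ) + 2 * Real.pi * Complex.I * (σ * ξ : ℝ)) ^ (s - 1 : ℂ)) (𝓝[>] 0)
      (𝓝 (fracSymbol s σ ξ)) := by
  unfold fracSymbol
  rcases eq_or_ne ξ 0 with rfl | hξ
  · simp [Complex.zero_cpow (Complex.ofReal_ne_zero.2 hs.1.ne')]
  have hσ0 : σ ≠ 0 := by rcases hσ with rfl | rfl <;> norm_num
  set z : ℂ := 2 * Real.pi * Complex.I * (σ * ξ : ℝ) with hz
  have hz0 : z ≠ 0 := by simp [hz, hσ0, hξ, Real.pi_ne_zero]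
  have hslit : z ∈ Complex.slitPlane := Or.inr (by simp [hz, hσ0, hξ, Real.pi_ne_zero])
  have h1 : ContinuousAt (fun ε : ℝ => z * ((ε : ℂ) + z) ^ (s - 1 : ℂ)) 0 := by
    refine continuousAt_const.mul (ContinuousAt.cpow ?_ continuousAt_const (by simpa using hslit))
    fun_prop
  have h2 := h1.tendsto.mono_left (nhdsWithin_le_nhds (s := Ioi 0))
  rwa [Complex.ofReal_zero, zero_add, Complex.cpow_sub _ _ hz0, Complex.cpow_one,
    mul_div_cancel₀ _ hz0] at h2

theorem norm_fracSymbol {s σ : ℝ} (hσ : σ = 1 ∨ σ = -1) (ξ : ℝ) :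
    ‖fracSymbol s σ ξ‖ = (2 * Real.pi * |ξ|) ^ s := by
  have : |σ| = 1 := by rcases hσ with rfl | rfl <;> simp
  rw [fracSymbol, Complex.norm_cpow_real]
  simp [this, abs_of_pos Real.pi_pos]

theorem kern_regularised {s σ : ℝ} (ε y : ℝ) :
    kern s σ ε y = kern s σ 0 y * Real.exp (-(ε * (σ * y))) := by
  unfold kern
  by_cases hy : σ * y ∈ Ioi (0 : ℝ)
  · rw [indicator_of_mem hy, indicator_of_mem hy]
    simp [mul_assoc]
  · rw [indicator_of_notMem hy, indicator_of_notMem hy, zero_mul]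

theorem kern_eq_zero {s σ ε y : ℝ} (h : σ * y ≤ 0) : kern s σ ε y = 0 :=
  indicator_of_notMem (by simpa using h) _

theorem abs_kern_regularised_le {s σ ε : ℝ} (hε : 0 ≤ ε) (y : ℝ) :
    |kern s σ ε y| ≤ |kern s σ 1 y| * Real.exp |σ * y| := by
  rcases le_or_gt (σ * y) 0 with h | h
  · simp [kern_eq_zero h]
  · rw [kern_regularised ε, kern_regularised 1, abs_mul, abs_mul, abs_of_pos (Real.exp_pos _),
      abs_of_pos (Real.exp_pos _), mul_assoc, ← Real.exp_add, abs_of_pos h]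
    gcongr
    nlinarith [mul_nonneg hε h.le]

/-- Only `t ∈ (0,1)` contributes, where `|x - t| ≤ |x| + 1`; losing the exponential decay thus costs
a locally bounded factor. The integrable kernel with `ε = 1` dominates all `ε ≥ 0`, including the
non-integrable case `ε = 0`. -/
theorem norm_fracInt_integrand_le {s σ ε : ℝ} (hσ : σ = 1 ∨ σ = -1) (hε : 0 ≤ ε) {U : ℝ → ℂ}
    (hU : ∀ t, t ∉ Ioo (0 : ℝ) 1 → U t = 0) (x t : ℝ) :
    ‖U t * (kern s σ ε (x - t) : ℂ)‖ ≤
      Real.exp (|x| + 1) * ‖U t * (kern s σ 1 (x - t) : ℂ)‖ := by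
  by_cases ht : t ∈ Ioo (0 : ℝ) 1
  · have h1 : |σ * (x - t)| ≤ |x| + 1 := by
      have : |σ| = 1 := by rcases hσ with rfl | rfl <;> simp
      rw [abs_mul, this, one_mul]
      refine (abs_sub _ _).trans ?_
      rw [abs_of_pos ht.1]
      linarith [ht.2]
    simp only [norm_mul, Complex.norm_real, Real.norm_eq_abs]
    calc ‖U t‖ * |kern s σ ε (x - t)|
        ≤ ‖U t‖ * (|kern s σ 1 (x - t)| * Real.exp (|x| + 1)) := by
          gcongr
          exact (abs_kern_regularised_le hε _).trans (by gcongr)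
      _ = _ := by ring
  · simp [hU t ht]

section

variable {s σ : ℝ} {U : ℝ → ℂ}

theorem ae_integrable_fracInt_integrand (hs : s < 1) (hσ : σ = 1 ∨ σ = -1) (hU : Integrable U)
    (hU0 : ∀ t, t ∉ Ioo (0 : ℝ) 1 → U t = 0) :
    ∀ᵐ x, ∀ ε, 0 ≤ ε → Integrable fun t => U t * (kern s σ ε (x - t) : ℂ) := by
  filter_upwards [hU.ae_convolution_exists (ContinuousLinearMap.mul ℂ ℂ)
    (integrable_kern hs hσ one_pos)] with x hx ε hε
  have hx' : Integrable fun t => U t * (kern s σ 1 (x - t) : ℂ) := hx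
  refine (hx'.norm.const_mul (Real.exp (|x| + 1))).mono' ?_
    (.of_forall fun t => norm_fracInt_integrand_le hσ hε hU0 x t)
  refine hU.1.mul (Measurable.aestronglyMeasurable ?_)
  exact Complex.measurable_ofReal.comp ((measurable_kern s σ ε).comp (by fun_prop))

theorem norm_fracInt_le (hs : s < 1) (hσ : σ = 1 ∨ σ = -1) (hU : Integrable U)
    (hU0 : ∀ t, t ∉ Ioo (0 : ℝ) 1 → U t = 0) :
    ∀ᵐ x, ∀ ε, 0 ≤ ε → ‖fracInt s σ ε U x‖ ≤
      Real.exp (|x| + 1) * ∫ t, ‖U t * (kern s σ 1 (x - t) : ℂ)‖ := by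
  filter_upwards [ae_integrable_fracInt_integrand hs hσ hU hU0] with x hx ε hε
  rw [← integral_const_mul]
  exact (norm_integral_le_integral_norm _).trans (integral_mono (hx ε hε).norm
    ((hx 1 zero_le_one).norm.const_mul _) fun t => norm_fracInt_integrand_le hσ hε hU0 x t)

theorem integrable_integral_norm (hs : s < 1) (hσ : σ = 1 ∨ σ = -1) (hU : Integrable U) :
    Integrable fun x => ∫ t, ‖U t * (kern s σ 1 (x - t) : ℂ)‖ :=
  (hU.convolution_integrand (ContinuousLinearMap.mul ℂ ℂ)
    (integrable_kern hs hσ one_pos)).norm.integral_prod_left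

theorem tendsto_fracInt (hs : s < 1) (hσ : σ = 1 ∨ σ = -1) (hU : Integrable U)
    (hU0 : ∀ t, t ∉ Ioo (0 : ℝ) 1 → U t = 0) :
    ∀ᵐ x, Tendsto (fun ε => fracInt s σ ε U x) (𝓝[>] 0) (𝓝 (fracInt s σ 0 U x)) := by
  filter_upwards [ae_integrable_fracInt_integrand hs hσ hU hU0] with x hx
  refine tendsto_integral_filter_of_dominated_convergence
    (fun t => Real.exp (|x| + 1) * ‖U t * (kern s σ 1 (x - t) : ℂ)‖) ?_ ?_
    ((hx 1 zero_le_one).norm.const_mul _) (.of_forall fun t => ?_)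
  · filter_upwards [self_mem_nhdsWithin] with ε hε
    exact (hx ε (le_of_lt hε)).1
  · filter_upwards [self_mem_nhdsWithin] with ε hε
    exact .of_forall fun t => norm_fracInt_integrand_le hσ (le_of_lt hε) hU0 x t
  · have h : Continuous fun ε : ℝ =>
        U t * ((kern s σ 0 (x - t) * Real.exp (-(ε * (σ * (x - t)))) : ℝ) : ℂ) := by fun_prop
    have h' := (h.tendsto 0).mono_left (nhdsWithin_le_nhds (s := Ioi 0))
    simp only [← kern_regularised] at h'
    exact h'

theorem aestronglyMeasurable_fracInt (hs : s < 1) (hσ : σ = 1 ∨ σ = -1) (hU : Integrable U)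
    (hU0 : ∀ t, t ∉ Ioo (0 : ℝ) 1 → U t = 0) : AEStronglyMeasurable (fracInt s σ 0 U) := by
  have h0 : Tendsto (fun n : ℕ => 1 / ((n : ℝ) + 1)) atTop (𝓝[>] 0) :=
    tendsto_nhdsWithin_iff.2 ⟨tendsto_one_div_add_atTop_nhds_zero_nat,
      .of_forall fun n => by simp only [mem_Ioi]; positivity⟩
  -- The kernel with `ε = 0` is not in `L¹(ℝ)`, so measurability comes from the limit `ε = 1/(n+1)`.
  refine aestronglyMeasurable_of_tendsto_ae atTop
    (f := fun n : ℕ => fracInt s σ (1 / ((n : ℝ) + 1)) U) (fun n => ?_) ?_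
  · exact (integrable_fracInt hs hσ (by positivity) hU).1
  · filter_upwards [tendsto_fracInt hs hσ hU hU0] with x hx
    exact hx.comp h0

theorem locallyIntegrable_fracInt (hs : s < 1) (hσ : σ = 1 ∨ σ = -1) (hU : Integrable U)
    (hU0 : ∀ t, t ∉ Ioo (0 : ℝ) 1 → U t = 0) : LocallyIntegrable (fracInt s σ 0 U) := by
  have h1 : LocallyIntegrable fun x =>
      Real.exp (|x| + 1) * ∫ t, ‖U t * (kern s σ 1 (x - t) : ℂ)‖ := by
    have h2 := (integrable_integral_norm hs hσ hU).locallyIntegrable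
    exact locallyIntegrableOn_univ.1 ((locallyIntegrableOn_univ.2 h2).continuousOn_mul
      (by fun_prop) isOpen_univ.isLocallyClosed)
  refine h1.mono (aestronglyMeasurable_fracInt hs hσ hU hU0) ?_
  filter_upwards [norm_fracInt_le hs hσ hU hU0] with x hx
  exact (hx 0 le_rfl).trans (le_abs_self _)

theorem tendsto_integral_smul_fracInt (hs : s < 1) (hσ : σ = 1 ∨ σ = -1) (hU : Integrable U)
    (hU0 : ∀ t, t ∉ Ioo (0 : ℝ) 1 → U t = 0) {χ : ℝ → ℝ} (h1 : Continuous χ)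
    (h2 : HasCompactSupport χ) :
    Tendsto (fun ε => ∫ x, χ x • fracInt s σ ε U x) (𝓝[>] 0)
      (𝓝 (∫ x, χ x • fracInt s σ 0 U x)) := by
  refine tendsto_integral_filter_of_dominated_convergence
    (fun x => (|χ x| * Real.exp (|x| + 1)) * ∫ t, ‖U t * (kern s σ 1 (x - t) : ℂ)‖) ?_ ?_ ?_ ?_
  · filter_upwards [self_mem_nhdsWithin] with ε hε
    exact h1.aestronglyMeasurable.smul (integrable_fracInt hs hσ hε hU).1
  · filter_upwards [self_mem_nhdsWithin] with ε hε
    filter_upwards [norm_fracInt_le hs hσ hU hU0] with x hx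
    rw [norm_smul, mul_assoc, Real.norm_eq_abs]
    gcongr
    exact hx ε (le_of_lt hε)
  · have hc : Continuous fun x => |χ x| * Real.exp (|x| + 1) := by fun_prop
    have hcs : HasCompactSupport fun x => |χ x| * Real.exp (|x| + 1) :=
      HasCompactSupport.mul_right (h2.comp_left (g := fun y : ℝ => |y|) abs_zero)
    obtain ⟨C, hC⟩ := hcs.exists_bound_of_continuous hc
    exact (integrable_integral_norm hs hσ hU).bdd_mul hc.aestronglyMeasurable (.of_forall hC)
  · filter_upwards [tendsto_fracInt hs hσ hU hU0] with x hx
    exact hx.const_smul _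

/-- The weak derivative of the fractional integral, in terms of Fourier transforms. -/
theorem integral_deriv_smul_fracInt_zero (hs : s ∈ Ioo (0 : ℝ) 1) (hσ : σ = 1 ∨ σ = -1)
    (hU : Integrable U) (hU0 : ∀ t, t ∉ Ioo (0 : ℝ) 1 → U t = 0)
    (hsym : MemLp (fun ξ => fracSymbol s σ ξ * 𝓕 U ξ) 2)
    {η : ℝ → ℝ} (h1 : ContDiff ℝ ∞ η) (h2 : HasCompactSupport η) :
    ∫ x, deriv η x • fracInt s σ 0 U x =
      -∫ x, η x • (𝓕⁻ (hsym.toLp _) : Lp ℂ 2 (volume : Measure ℝ)) x := by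
  have e1 := tendsto_integral_smul_fracInt hs.2 hσ hU hU0
    (contDiff_infty_iff_deriv.1 h1).2.continuous h2.deriv
  -- Both sides are limits of the same regularised integrals: one in the variable `x`, the other in
  -- the frequency, dominated by the unregularised symbol.
  refine tendsto_nhds_unique e1 ?_
  have e2 : ∀ᶠ ε : ℝ in 𝓝[>] 0, -∫ ξ, 𝓕⁻ (testSchwartz h1 h2) ξ *
      ((2 * Real.pi * Complex.I * (σ * ξ : ℝ)) *
        ((ε : ℂ) + 2 * Real.pi * Complex.I * (σ * ξ : ℝ)) ^ (s - 1 : ℂ) * 𝓕 U ξ) =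
      ∫ x, deriv η x • fracInt s σ ε U x := by
    filter_upwards [self_mem_nhdsWithin] with ε hε
    exact (integral_deriv_smul_fracInt hs.2 hσ hε hU h1 h2).symm
  refine Tendsto.congr' e2 (Tendsto.neg ?_)
  have e3 := integral_smul_fourierInv_toLp (testSchwartz h1 h2) (hsym.toLp _)
  simp only [testSchwartz_apply, Complex.coe_smul] at e3
  have e4 : ∫ ξ, 𝓕⁻ (testSchwartz h1 h2) ξ • (hsym.toLp _) ξ =
      ∫ ξ, 𝓕⁻ (testSchwartz h1 h2) ξ * (fracSymbol s σ ξ * 𝓕 U ξ) :=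
    integral_congr_ae (hsym.coeFn_toLp.mono fun x hx => by simp only [hx, smul_eq_mul])
  rw [e3, e4]
  have hm : AEStronglyMeasurable (𝓕 U) := (continuous_fourier_of_integrable hU).aestronglyMeasurable
  have hm' : AEStronglyMeasurable (𝓕⁻ (testSchwartz h1 h2) : 𝓢(ℝ, ℂ)) :=
    (𝓕⁻ (testSchwartz h1 h2) : 𝓢(ℝ, ℂ)).continuous.aestronglyMeasurable
  refine tendsto_integral_filter_of_dominated_convergence
    (fun ξ => ‖𝓕⁻ (testSchwartz h1 h2) ξ * (fracSymbol s σ ξ * 𝓕 U ξ)‖) (.of_forall fun ε => ?_)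
    ?_ (Integrable.norm ?_) (.of_forall fun ξ => ?_)
  · refine hm'.mul (AEStronglyMeasurable.mul (Measurable.aestronglyMeasurable ?_) hm)
    fun_prop
  · filter_upwards [self_mem_nhdsWithin] with ε hε
    refine .of_forall fun ξ => ?_
    rw [norm_mul, norm_mul (_ * _) (𝓕 U ξ), norm_mul _ (fracSymbol s σ ξ * 𝓕 U ξ),
      norm_mul (fracSymbol s σ ξ), norm_fracSymbol hσ]
    gcongr
    exact norm_symbol_regularised_le hs hσ ξ
  · exact MemLp.integrable_mul (p := 2) (q := 2) ((𝓕⁻ (testSchwartz h1 h2) : 𝓢(ℝ, ℂ)).memLp 2) hsym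
  · exact ((tendsto_symbol_regularised hs hσ ξ).mul_const _).const_mul _

end

/-! ### The Riemann–Liouville derivatives in terms of Fourier transforms -/

/-- The zero extension of `u` as a function. -/
def zeroExtFun (u : L2I) : ℝ → ℂ := (Ioo (0 : ℝ) 1).indicator (u : ℝ → ℂ)

theorem zeroExtFun_of_notMem (u : L2I) (t : ℝ) (ht : t ∉ Ioo (0 : ℝ) 1) : zeroExtFun u t = 0 :=
  indicator_of_notMem ht _

theorem zeroExtFun_of_mem (u : L2I) {t : ℝ} (ht : t ∈ Ioo (0 : ℝ) 1) :
    zeroExtFun u t = (u : ℝ → ℂ) t := indicator_of_mem ht _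

theorem integrable_zeroExtFun (u : L2I) : Integrable (zeroExtFun u) :=
  IntegrableOn.integrable_indicator ((Lp.memLp u).integrable (by norm_num)) measurableSet_Ioo

/-- Restriction `L²(ℝ) → L²(0,1)`. -/
def restrictL : Lp ℂ 2 (volume : Measure ℝ) →L[ℂ] L2I :=
  LpToLpRestrictCLM ℝ ℂ ℂ volume 2 (Ioo (0 : ℝ) 1)

theorem coeFn_restrictL (g : Lp ℂ 2 (volume : Measure ℝ)) :
    restrictL g =ᵐ[volume.restrict (Ioo (0 : ℝ) 1)] g :=
  LpToLpRestrictCLM_coeFn ℂ _ g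

section

variable {s σ : ℝ} {u : L2I}

/-- The fractional derivative of the zero extension of `u`, as a function in `L²(ℝ)`. -/
def fracDeriv (hsym : MemLp (fun ξ => fracSymbol s σ ξ * 𝓕 (zeroExtFun u) ξ) 2) :
    Lp ℂ 2 (volume : Measure ℝ) := 𝓕⁻ (hsym.toLp _)

theorem hasWeakDeriv_fracInt (hs : s ∈ Ioo (0 : ℝ) 1) (hσ : σ = 1 ∨ σ = -1)
    (hsym : MemLp (fun ξ => fracSymbol s σ ξ * 𝓕 (zeroExtFun u) ξ) 2) :
    HasWeakDeriv (fracInt s σ 0 (zeroExtFun u)) (restrictL (fracDeriv hsym)) := by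
  refine ⟨(locallyIntegrable_fracInt hs.2 hσ (integrable_zeroExtFun u)
    (zeroExtFun_of_notMem u)).locallyIntegrableOn _, locallyIntegrableOn_L2I _, fun η hη => ?_⟩
  have h := integral_deriv_smul_fracInt_zero hs hσ (integrable_zeroExtFun u)
    (zeroExtFun_of_notMem u) hsym hη.1 hη.2.1
  have e1 := setIntegral_eq_integral_of_forall_compl_eq_zero (s := Ioo (0 : ℝ) 1) (μ := volume)
    (f := fun x => deriv η x • fracInt s σ 0 (zeroExtFun u) x) fun x hx => by
      rw [image_eq_zero_of_notMem_tsupport (fun h => hx (hη.2.2 (tsupport_deriv_subset h))),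
        zero_smul]
  have e2 := setIntegral_eq_integral_of_forall_compl_eq_zero (s := Ioo (0 : ℝ) 1) (μ := volume)
    (f := fun x => η x • fracDeriv hsym x) fun x hx => by
      rw [image_eq_zero_of_notMem_tsupport (fun h => hx (hη.2.2 h)), zero_smul]
  rw [e1, h]
  refine congrArg Neg.neg (e2.symm.trans ?_)
  refine integral_congr_ae ?_
  filter_upwards [coeFn_restrictL (fracDeriv hsym)] with x hx
  rw [hx]

/-- Distributional derivatives are local: it suffices to test with functions supported in `V`. -/
theorem fracDeriv_ae_eq_zero (hs : s ∈ Ioo (0 : ℝ) 1) (hσ : σ = 1 ∨ σ = -1)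
    (hsym : MemLp (fun ξ => fracSymbol s σ ξ * 𝓕 (zeroExtFun u) ξ) 2) {V : Set ℝ} (hV : IsOpen V)
    (h0 : ∀ x ∈ V, fracInt s σ 0 (zeroExtFun u) x = 0) :
    ∀ᵐ x, x ∈ V → fracDeriv hsym x = 0 := by
  refine hV.ae_eq_zero_of_integral_contDiff_smul_eq_zero
    (((Lp.memLp _).locallyIntegrable (by norm_num)).locallyIntegrableOn _) fun η h1 h2 h3 => ?_
  have h := integral_deriv_smul_fracInt_zero hs hσ (integrable_zeroExtFun u)
    (zeroExtFun_of_notMem u) hsym h1 h2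
  have h' : ∀ x, deriv η x • fracInt s σ 0 (zeroExtFun u) x = 0 := fun x => by
    by_cases hx : x ∈ V
    · rw [h0 x hx, smul_zero]
    · rw [image_eq_zero_of_notMem_tsupport (fun h => hx (h3 (tsupport_deriv_subset h))), zero_smul]
  simp only [h', integral_zero, zero_eq_neg] at h
  exact h

/-- The kernel removes `t ≥ x` and the zero extension removes `t ∉ (0,1)`; as `x < 1`, what is left
is `(0,x)`, which is empty for `x ≤ 0`. -/
theorem fracInt_one_integrand {x : ℝ} (hx : x < 1) (t : ℝ) :
    zeroExtFun u t * (kern s 1 0 (x - t) : ℂ) = (Ioo 0 x).indicator (fun t =>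
      (1 / Real.Gamma (1 - s)) • ((x - t) ^ (-s) • (u : ℝ → ℂ) t)) t := by
  by_cases ht : t ∈ Ioo 0 x
  · have h1 : (1 : ℝ) * (x - t) ∈ Ioi (0 : ℝ) := by simpa using ht.2
    rw [indicator_of_mem ht, zeroExtFun_of_mem u ⟨ht.1, ht.2.trans hx⟩, kern, indicator_of_mem h1]
    simp only [Complex.real_smul]
    push_cast
    simp
    ring
  · rw [indicator_of_notMem ht]
    by_cases h0 : t ∈ Ioo (0 : ℝ) 1
    · rw [kern_eq_zero (by simpa using le_of_not_gt fun h => ht ⟨h0.1, h⟩)]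
      simp
    · rw [zeroExtFun_of_notMem u t h0, zero_mul]

theorem fracInt_neg_one_integrand {x : ℝ} (hx : 0 < x) (t : ℝ) :
    zeroExtFun u t * (kern s (-1) 0 (x - t) : ℂ) = (Ioo x 1).indicator (fun t =>
      (-1 / Real.Gamma (1 - s)) • ((t - x) ^ (-s) • (u : ℝ → ℂ) t)) t := by
  by_cases ht : t ∈ Ioo x 1
  · have h1 : (-1 : ℝ) * (x - t) ∈ Ioi (0 : ℝ) := by simpa using ht.1
    rw [indicator_of_mem ht, zeroExtFun_of_mem u ⟨hx.trans ht.1, ht.2⟩, kern, indicator_of_mem h1]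
    simp only [Complex.real_smul]
    rw [show -1 * (x - t) = t - x by ring]
    push_cast
    simp
    ring
  · rw [indicator_of_notMem ht]
    by_cases h0 : t ∈ Ioo (0 : ℝ) 1
    · rw [kern_eq_zero (by simpa using le_of_not_gt fun h => ht ⟨h, h0.2⟩)]
      simp
    · rw [zeroExtFun_of_notMem u t h0, zero_mul]

theorem one_div_Gamma_ne_zero (hs : s < 1) : 1 / Real.Gamma (1 - s) ≠ 0 :=
  one_div_ne_zero (Real.Gamma_pos_of_pos (by linarith)).ne'

theorem mem_graph_leftRL_of_memLp (hs : s ∈ Ioo (0 : ℝ) 1)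
    (hsym : MemLp (fun ξ => fracSymbol s 1 ξ * 𝓕 (zeroExtFun u) ξ) 2) :
    (u, restrictL (fracDeriv hsym)) ∈ (leftRL s).graph := by
  rw [mem_graph_leftRL]
  have hm : ∀ᵐ x ∂(volume.restrict (Ioo (0 : ℝ) 1)), x ∈ Ioo (0 : ℝ) 1 :=
    ae_restrict_mem measurableSet_Ioo
  constructor
  · filter_upwards [hm, ae_restrict_of_ae (ae_integrable_fracInt_integrand hs.2 (Or.inl rfl)
      (integrable_zeroExtFun u) (zeroExtFun_of_notMem u))] with x hx h
    have h' := h 0 le_rfl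
    simp only [fracInt_one_integrand hx.2] at h'
    rw [integrable_indicator_iff measurableSet_Ioo] at h'
    exact (integrable_fun_smul_iff (one_div_Gamma_ne_zero hs.2) _).1 h'
  · refine (hasWeakDeriv_fracInt hs (Or.inl rfl) hsym).congr ?_ (Filter.EventuallyEq.refl _ _)
    filter_upwards [hm] with x hx
    rw [fracInt]
    simp only [fracInt_one_integrand hx.2]
    rw [integral_indicator measurableSet_Ioo, integral_smul]

theorem mem_graph_rightRL_of_memLp (hs : s ∈ Ioo (0 : ℝ) 1)
    (hsym : MemLp (fun ξ => fracSymbol s (-1) ξ * 𝓕 (zeroExtFun u) ξ) 2) :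
    (u, restrictL (fracDeriv hsym)) ∈ (rightRL s).graph := by
  rw [mem_graph_rightRL]
  have hm : ∀ᵐ x ∂(volume.restrict (Ioo (0 : ℝ) 1)), x ∈ Ioo (0 : ℝ) 1 :=
    ae_restrict_mem measurableSet_Ioo
  have hΓ : -1 / Real.Gamma (1 - s) ≠ 0 := by
    rw [neg_div]
    exact neg_ne_zero.2 (one_div_Gamma_ne_zero hs.2)
  constructor
  · filter_upwards [hm, ae_restrict_of_ae (ae_integrable_fracInt_integrand hs.2 (Or.inr rfl)
      (integrable_zeroExtFun u) (zeroExtFun_of_notMem u))] with x hx h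
    have h' := h 0 le_rfl
    simp only [fracInt_neg_one_integrand hx.1] at h'
    rw [integrable_indicator_iff measurableSet_Ioo] at h'
    exact (integrable_fun_smul_iff hΓ _).1 h'
  · refine (hasWeakDeriv_fracInt hs (Or.inr rfl) hsym).congr ?_ (Filter.EventuallyEq.refl _ _)
    filter_upwards [hm] with x hx
    rw [fracInt]
    simp only [fracInt_neg_one_integrand hx.1]
    rw [integral_indicator measurableSet_Ioo, integral_smul]

/-! ### Supports of the one-sided derivatives and Plancherel on the interval. -/

theorem fracDeriv_one_ae_eq_zero (hs : s ∈ Ioo (0 : ℝ) 1)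
    (hsym : MemLp (fun ξ => fracSymbol s 1 ξ * 𝓕 (zeroExtFun u) ξ) 2) :
    ∀ᵐ x, x ∈ Iio (0 : ℝ) → fracDeriv hsym x = 0 := by
  refine fracDeriv_ae_eq_zero hs (Or.inl rfl) hsym isOpen_Iio fun x hx => ?_
  rw [fracInt]
  simp only [fracInt_one_integrand (lt_trans hx one_pos), Ioo_eq_empty_of_le (le_of_lt (mem_Iio.1 hx)),
    indicator_empty, integral_zero]

theorem fracDeriv_neg_one_ae_eq_zero (hs : s ∈ Ioo (0 : ℝ) 1)
    (hsym : MemLp (fun ξ => fracSymbol s (-1) ξ * 𝓕 (zeroExtFun u) ξ) 2) :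
    ∀ᵐ x, x ∈ Ioi (1 : ℝ) → fracDeriv hsym x = 0 := by
  refine fracDeriv_ae_eq_zero hs (Or.inr rfl) hsym isOpen_Ioi fun x hx => ?_
  rw [fracInt]
  simp only [fracInt_neg_one_integrand (lt_trans one_pos hx), Ioo_eq_empty_of_le (le_of_lt (mem_Ioi.1 hx)),
    indicator_empty, integral_zero]

theorem inner_restrictL_of_ae {g h : Lp ℂ 2 (volume : Measure ℝ)}
    (hz : ∀ᵐ x, x ∉ Ioo (0 : ℝ) 1 → g x = 0 ∨ h x = 0) :
    inner ℂ (restrictL g) (restrictL h) = inner ℂ g h := by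
  rw [MeasureTheory.L2.inner_def, MeasureTheory.L2.inner_def]
  rw [← setIntegral_eq_integral_of_ae_compl_eq_zero (s := Ioo (0 : ℝ) 1) (μ := volume)]
  · refine integral_congr_ae ?_
    filter_upwards [coeFn_restrictL g, coeFn_restrictL h] with x hg hh
    rw [hg, hh]
  · filter_upwards [hz] with x hx hm
    rcases hx hm with h | h <;> simp [h]

/-- The product of a left and a right derivative lives on `(0,1)`; Plancherel. -/
theorem inner_restrictL_fracDeriv (hs : s ∈ Ioo (0 : ℝ) 1) {v : L2I}
    (hu : MemLp (fun ξ => fracSymbol s 1 ξ * 𝓕 (zeroExtFun u) ξ) 2)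
    (hv : MemLp (fun ξ => fracSymbol s (-1) ξ * 𝓕 (zeroExtFun v) ξ) 2) :
    inner ℂ (restrictL (fracDeriv hv)) (restrictL (fracDeriv hu)) =
      inner ℂ (hv.toLp _) (hu.toLp _) := by
  rw [inner_restrictL_of_ae]
  · exact (Lp.fourierTransformₗᵢ ℝ ℂ).symm.inner_map_map _ _
  -- The vanishing is known on open half-lines only, so the endpoints are discarded as a null set.
  · have h01 : ∀ᵐ x : ℝ, x ∉ ({0, 1} : Set ℝ) :=
      (Set.toFinite ({0, 1} : Set ℝ)).countable.ae_notMem _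
    filter_upwards [h01, fracDeriv_one_ae_eq_zero hs hu, fracDeriv_neg_one_ae_eq_zero hs hv]
      with x hx h1 h2 hm
    simp only [mem_insert_iff, mem_singleton_iff, not_or] at hx
    rcases lt_or_gt_of_ne hx.1 with h | h
    · exact Or.inr (h1 h)
    · refine Or.inl (h2 (lt_of_le_of_ne (le_of_not_gt fun h' => hm ⟨h, h'⟩) (Ne.symm hx.2)))

end

/-! ### Multiplication operators on `L²(ℝ)` -/

/-- Multiplication by an essentially bounded function on `L²(ℝ)`. -/
def mulL {m : ℝ → ℂ} (hm : MemLp m ⊤ (volume : Measure ℝ)) :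
    Lp ℂ 2 (volume : Measure ℝ) →L[ℂ] Lp ℂ 2 (volume : Measure ℝ) :=
  (ContinuousLinearMap.mul ℂ ℂ).holderL volume ⊤ 2 2 (hm.toLp m)

theorem coeFn_mulL {m : ℝ → ℂ} (hm : MemLp m ⊤ (volume : Measure ℝ))
    (w : Lp ℂ 2 (volume : Measure ℝ)) : mulL hm w =ᵐ[volume] fun ξ => m ξ * w ξ := by
  filter_upwards [(ContinuousLinearMap.mul ℂ ℂ).coeFn_holder (r := 2) (hm.toLp m) w,
    hm.coeFn_toLp] with ξ h1 h2
  have : mulL hm w ξ = (ContinuousLinearMap.mul ℂ ℂ).holder 2 (hm.toLp m) w ξ := rfl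
  rw [this, h1, h2]
  rfl

theorem inner_mulL_mulL {a b : ℝ → ℂ} (ha : MemLp a ⊤ (volume : Measure ℝ))
    (hb : MemLp b ⊤ (volume : Measure ℝ)) (v w : Lp ℂ 2 (volume : Measure ℝ)) :
    inner ℂ (mulL ha v) (mulL hb w) =
      ∫ ξ, (starRingEnd ℂ (a ξ) * b ξ) * (w ξ * starRingEnd ℂ (v ξ)) := by
  rw [MeasureTheory.L2.inner_def]
  refine integral_congr_ae ?_
  filter_upwards [coeFn_mulL ha v, coeFn_mulL hb w] with ξ h1 h2
  rw [h1, h2]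
  simp
  ring

/-! ### The Bessel weight -/

/-- The weight `(1 + ξ²)^(-s/2)`. -/
def bessel (s ξ : ℝ) : ℝ := (1 + ‖ξ‖ ^ 2) ^ (-s / 2)

theorem bessel_pos (s ξ : ℝ) : 0 < bessel s ξ := by unfold bessel; positivity

theorem hasTemperateGrowth_bessel (s : ℝ) : (fun ξ => (bessel s ξ : ℂ)).HasTemperateGrowth := by
  unfold bessel
  fun_prop

theorem bessel_le_one {s : ℝ} (hs : 0 ≤ s) (ξ : ℝ) : bessel s ξ ≤ 1 :=
  Real.rpow_le_one_of_one_le_of_nonpos (by simp; positivity) (by linarith)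

theorem bessel_sq (s ξ : ℝ) : bessel s ξ ^ 2 * (1 + ξ ^ 2) ^ s = 1 := by
  have h : (0 : ℝ) < 1 + ξ ^ 2 := by positivity
  rw [bessel, ← Real.rpow_natCast, ← Real.rpow_mul (by positivity), Real.norm_eq_abs, sq_abs,
    ← Real.rpow_add h]
  norm_num

theorem memLp_bessel {s : ℝ} (hs : 0 ≤ s) :
    MemLp (fun ξ => (bessel s ξ : ℂ)) ⊤ (volume : Measure ℝ) :=
  memLp_top_of_bound (hasTemperateGrowth_bessel s).1.continuous.aestronglyMeasurable 1
    (.of_forall fun ξ => by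
      rw [Complex.norm_real, Real.norm_of_nonneg (bessel_pos s ξ).le]
      exact bessel_le_one hs ξ)

/-- Since `|ξ|^s ≤ (1+ξ²)^(s/2)`, the derivatives act on the weighted transforms as bounded
multiplication operators. -/
theorem norm_fracSymbol_mul_bessel_le {s σ : ℝ} (hs : 0 ≤ s) (hσ : σ = 1 ∨ σ = -1) (ξ : ℝ) :
    ‖fracSymbol s σ ξ * bessel s ξ‖ ≤ (2 * Real.pi) ^ s := by
  rw [norm_mul, norm_fracSymbol hσ, Complex.norm_real, Real.norm_of_nonneg (bessel_pos s ξ).le,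
    Real.mul_rpow (by positivity) (abs_nonneg _), mul_assoc]
  refine mul_le_of_le_one_right (by positivity) ?_
  have h1 : |ξ| ^ s ≤ (1 + ‖ξ‖ ^ 2) ^ (s / 2) := by
    have : |ξ| ^ s = (‖ξ‖ ^ 2) ^ (s / 2) := by
      rw [← Real.rpow_natCast, ← Real.rpow_mul (norm_nonneg _), Real.norm_eq_abs]
      congr 1
      push_cast
      ring
    rw [this]
    gcongr
    linarith
  calc |ξ| ^ s * bessel s ξ ≤ (1 + ‖ξ‖ ^ 2) ^ (s / 2) * (1 + ‖ξ‖ ^ 2) ^ (-s / 2) := by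
        unfold bessel
        gcongr
    _ = 1 := by
        rw [← Real.rpow_add (by positivity)]
        ring_nf
        simp

theorem memLp_fracSymbol_mul_bessel {s σ : ℝ} (hs : 0 ≤ s) (hσ : σ = 1 ∨ σ = -1) :
    MemLp (fun ξ => fracSymbol s σ ξ * bessel s ξ) ⊤ (volume : Measure ℝ) := by
  refine memLp_top_of_bound ?_ ((2 * Real.pi) ^ s)
    (.of_forall (norm_fracSymbol_mul_bessel_le hs hσ))
  exact (measurable_fracSymbol s σ).aestronglyMeasurable.mul
    (hasTemperateGrowth_bessel s).1.continuous.aestronglyMeasurable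

/-- Here `w` is `(1+ξ²)^(s/2) û`. Dividing by the weight puts the bounded function `bessel s` on the
other side, so the condition becomes an equation in `L²(ℝ)` instead of one between distributions. -/
theorem mem_Htilde_iff {s : ℝ} (hs : 0 ≤ s) (u : L2I) :
    u ∈ Htilde s ↔ ∃ w, mulL (memLp_bessel hs) w = 𝓕 (zeroExt u) := by
  change TemperedDistribution.MemSobolev s 2 (zeroExt u : 𝓢'(ℝ, ℂ)) ↔ _
  rw [TemperedDistribution.memSobolev_iff_exists_smulLeftCLM_fourier]
  have hT : ∀ w : Lp ℂ 2 (volume : Measure ℝ), (mulL (memLp_bessel hs) w : 𝓢'(ℝ, ℂ)) =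
      TemperedDistribution.smulLeftCLM ℂ (fun ξ : ℝ => (bessel s ξ : ℂ)) w := by
    intro w
    rw [← Lp.toTemperedDistribution_smul_eq (r := 2) (hasTemperateGrowth_bessel s)
      (memLp_bessel hs)]
    congr 1
  have hinv : (fun x : ℝ => (((1 + ‖x‖ ^ 2) ^ (s / 2) : ℝ) : ℂ)) * (fun ξ => (bessel s ξ : ℂ)) =
      fun _ => 1 := by
    ext x
    simp only [Pi.mul_apply, bessel]
    norm_cast
    rw [← Real.rpow_add (by positivity)]
    ring_nf
    simp
  have hg : (fun x : ℝ => (((1 + ‖x‖ ^ 2) ^ (s / 2) : ℝ) : ℂ)).HasTemperateGrowth := by fun_prop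
  refine exists_congr fun w => ?_
  rw [Lp.fourier_toTemperedDistribution_eq]
  constructor
  · intro h
    have h2 : ((mulL (memLp_bessel hs) w : Lp ℂ 2 (volume : Measure ℝ)) : 𝓢'(ℝ, ℂ)) =
        (𝓕 (zeroExt u) : Lp ℂ 2 (volume : Measure ℝ)) := by
      rw [hT, ← h, TemperedDistribution.smulLeftCLM_smulLeftCLM_apply
        hg (hasTemperateGrowth_bessel s), hinv]
      simp
    -- `L²(ℝ)` embeds injectively into the tempered distributions.
    exact LinearMap.ker_eq_bot.1 (Lp.ker_toTemperedDistributionCLM_eq_bot (F := ℂ)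
      (μ := (volume : Measure ℝ)) (p := 2)) h2
  · intro h
    rw [← h, hT, TemperedDistribution.smulLeftCLM_smulLeftCLM_apply
        (hasTemperateGrowth_bessel s) hg, mul_comm, hinv]
    simp

/-! ### Fractional derivatives and the form on `H̃ˢ` via weighted Fourier transforms. -/

section

variable {s σ : ℝ} {u : L2I} {w : Lp ℂ 2 (volume : Measure ℝ)}

theorem fracSymbol_mul_fourier_ae (hs : 0 ≤ s) (hσ : σ = 1 ∨ σ = -1)
    (hw : mulL (memLp_bessel hs) w = 𝓕 (zeroExt u)) :
    (fun ξ => fracSymbol s σ ξ * 𝓕 (zeroExtFun u) ξ) =ᵐ[volume]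
      mulL (memLp_fracSymbol_mul_bessel hs hσ) w := by
  have h1 : 𝓕 (zeroExtFun u) =ᵐ[volume] (𝓕 (zeroExt u) : Lp ℂ 2 (volume : Measure ℝ)) :=
    fourier_ae_eq_fourier_toLp (integrable_zeroExtFun u) (memLp_zeroExt u)
  rw [← hw] at h1
  filter_upwards [h1, coeFn_mulL (memLp_bessel hs) w,
    coeFn_mulL (memLp_fracSymbol_mul_bessel hs hσ) w] with ξ e1 e2 e3
  rw [e1, e2, e3, mul_assoc]

theorem memLp_fracSymbol_mul_fourier (hs : 0 ≤ s) (hσ : σ = 1 ∨ σ = -1)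
    (hw : mulL (memLp_bessel hs) w = 𝓕 (zeroExt u)) :
    MemLp (fun ξ => fracSymbol s σ ξ * 𝓕 (zeroExtFun u) ξ) 2 :=
  (memLp_congr_ae (fracSymbol_mul_fourier_ae hs hσ hw)).2 (Lp.memLp _)

theorem toLp_fracSymbol_mul_fourier (hs : 0 ≤ s) (hσ : σ = 1 ∨ σ = -1)
    (hw : mulL (memLp_bessel hs) w = 𝓕 (zeroExt u)) :
    (memLp_fracSymbol_mul_fourier hs hσ hw).toLp _ = mulL (memLp_fracSymbol_mul_bessel hs hσ) w :=
  Lp.ext ((MemLp.coeFn_toLp _).trans (fracSymbol_mul_fourier_ae hs hσ hw))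

end

theorem Htilde_le_domain_leftRL {s : ℝ} (hs : s ∈ Ioo (0 : ℝ) 1) : Htilde s ≤ (leftRL s).domain := by
  intro u hu
  obtain ⟨w, hw⟩ := (mem_Htilde_iff hs.1.le u).1 hu
  exact LinearPMap.mem_domain_of_mem_graph
    (mem_graph_leftRL_of_memLp hs (memLp_fracSymbol_mul_fourier hs.1.le (Or.inl rfl) hw))

theorem Htilde_le_domain_rightRL {s : ℝ} (hs : s ∈ Ioo (0 : ℝ) 1) :
    Htilde s ≤ (rightRL s).domain := by
  intro u hu
  obtain ⟨w, hw⟩ := (mem_Htilde_iff hs.1.le u).1 hu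
  exact LinearPMap.mem_domain_of_mem_graph
    (mem_graph_rightRL_of_memLp hs (memLp_fracSymbol_mul_fourier hs.1.le (Or.inr rfl) hw))

/-- The form on the Fourier side. -/
theorem form_eq {β : ℝ} (hs : β / 2 ∈ Ioo (0 : ℝ) 1)
    {hL : Htilde (β / 2) ≤ (leftRL (β / 2)).domain}
    {hR : Htilde (β / 2) ≤ (rightRL (β / 2)).domain} (φ ψ : Htilde (β / 2))
    {v w : Lp ℂ 2 (volume : Measure ℝ)} (hw : mulL (memLp_bessel hs.1.le) w = 𝓕 (zeroExt φ))
    (hv : mulL (memLp_bessel hs.1.le) v = 𝓕 (zeroExt ψ)) :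
    form β hL hR φ ψ = -inner ℂ (mulL (memLp_fracSymbol_mul_bessel hs.1.le (Or.inr rfl)) v)
      (mulL (memLp_fracSymbol_mul_bessel hs.1.le (Or.inl rfl)) w) := by
  have h1 : restrictL (fracDeriv (memLp_fracSymbol_mul_fourier hs.1.le (Or.inl rfl) hw)) =
      leftRL (β / 2) ⟨φ, hL φ.2⟩ :=
    (LinearPMap.image_iff (hL φ.2)).2 (mem_graph_leftRL_of_memLp hs _)
  have h2 : restrictL (fracDeriv (memLp_fracSymbol_mul_fourier hs.1.le (Or.inr rfl) hv)) =
      rightRL (β / 2) ⟨ψ, hR ψ.2⟩ :=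
    (LinearPMap.image_iff (hR ψ.2)).2 (mem_graph_rightRL_of_memLp hs _)
  rw [form, ← h1, ← h2, inner_restrictL_fracDeriv hs,
    toLp_fracSymbol_mul_fourier hs.1.le (Or.inl rfl) hw,
    toLp_fracSymbol_mul_fourier hs.1.le (Or.inr rfl) hv]

/-! ### Sectoriality of the symbol -/

/-- The base is purely imaginary, hence off the branch cut, and conjugation commutes with the power.
The form thereby contains the square of a single symbol. -/
theorem star_fracSymbol_neg_one (s ξ : ℝ) :
    starRingEnd ℂ (fracSymbol s (-1) ξ) = fracSymbol s 1 ξ := by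
  have harg : (2 * Real.pi * Complex.I * ((-1 * ξ : ℝ) : ℂ)).arg ≠ Real.pi := by
    intro h
    have h1 := Complex.arg_eq_pi_iff.1 h
    simp at h1
  have h := Complex.conj_cpow _ (s : ℂ) harg
  rw [Complex.conj_ofReal] at h
  rw [fracSymbol, ← h, fracSymbol]
  simp [Complex.conj_ofNat]

/-- For `ξ ≠ 0`, `τ` is the sign of `ξ`: the logarithm of `±i` is `±iπ/2`, and the exponent is `2s`
in total. -/
theorem fracSymbol_one_sq {s ξ : ℝ} (hs : 0 < s) : ∃ τ : ℝ, (τ = 1 ∨ τ = -1) ∧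
    fracSymbol s 1 ξ ^ 2 = ((2 * Real.pi * |ξ|) ^ (2 * s) : ℝ) *
      Complex.exp ((τ * (Real.pi * s) : ℝ) * Complex.I) := by
  rcases eq_or_ne ξ 0 with rfl | hξ
  · refine ⟨1, Or.inl rfl, ?_⟩
    simp [fracSymbol, Complex.zero_cpow (Complex.ofReal_ne_zero.2 hs.ne'), Real.zero_rpow, hs.ne']
  have hr : 0 < 2 * Real.pi * |ξ| := by have := Real.pi_pos; positivity
  have key : ∀ τ : ℝ, ∀ J : ℂ, J ≠ 0 → Complex.log J = (τ * (Real.pi / 2) : ℝ) * Complex.I →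
      2 * Real.pi * Complex.I * ((1 * ξ : ℝ) : ℂ) = (2 * Real.pi * |ξ| : ℝ) * J →
      fracSymbol s 1 ξ ^ 2 = ((2 * Real.pi * |ξ|) ^ (2 * s) : ℝ) *
        Complex.exp ((τ * (Real.pi * s) : ℝ) * Complex.I) := by
    intro τ J hJ hlog h
    rw [fracSymbol, h, Complex.cpow_def_of_ne_zero
      (mul_ne_zero (Complex.ofReal_ne_zero.2 hr.ne') hJ), Complex.log_ofReal_mul hr hJ, hlog,
      Real.rpow_def_of_pos hr, Complex.ofReal_exp, ← Complex.exp_nat_mul, ← Complex.exp_add]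
    congr 1
    push_cast
    ring
  rcases lt_or_gt_of_ne hξ with h | h
  · refine ⟨-1, Or.inr rfl, key (-1) (-Complex.I) (by simp) ?_ ?_⟩
    · rw [Complex.log_neg_I]
      push_cast
      ring
    · rw [abs_of_neg h]
      push_cast
      ring
  · refine ⟨1, Or.inl rfl, key 1 Complex.I (by simp) ?_ ?_⟩
    · rw [Complex.log_I]
      push_cast
      ring
    · rw [abs_of_pos h]
      push_cast
      ring

/-- An angle `γ` that rotates the sector `|arg| ≤ κ` into the right half-plane and the direction
`α` outside of it into the left half-plane. -/
theorem exists_separating_angle {κ α : ℝ} (h0 : 0 < κ) (h1 : κ < Real.pi / 4) (h2 : κ < |α|)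
    (h3 : |α| ≤ Real.pi) :
    ∃ γ : ℝ, 0 < Real.cos (γ - κ) ∧ 0 < Real.cos (γ + κ) ∧ Real.cos (γ + α) < 0 := by
  have hπ := Real.pi_pos
  have key : ∀ a : ℝ, κ < a → a ≤ Real.pi →
      ∃ γ : ℝ, 0 < Real.cos (γ - κ) ∧ 0 < Real.cos (γ + κ) ∧ Real.cos (γ + a) < 0 := by
    intro a ha ha'
    -- The midpoint of `(π/2 - a, π/2 - κ)`: it places `γ + κ` and `γ + a` symmetrically about
    -- `π/2`, while `κ < π/4` keeps `γ - κ` above `-π/2`.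
    refine ⟨Real.pi / 2 - κ - (a - κ) / 2, Real.cos_pos_of_mem_Ioo ⟨by linarith, by linarith⟩,
      Real.cos_pos_of_mem_Ioo ⟨by linarith, by linarith⟩,
      Real.cos_neg_of_pi_div_two_lt_of_lt (by linarith) (by linarith)⟩
  obtain ⟨γ, c1, c2, c3⟩ := key |α| h2 h3
  rcases le_total 0 α with h | h
  · rw [abs_of_nonneg h] at c3
    exact ⟨γ, c1, c2, c3⟩
  · rw [abs_of_nonpos h] at c3
    -- Reflection in the real axis, which swaps the two conditions on `κ`.
    refine ⟨-γ, ?_, ?_, ?_⟩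
    · rwa [← Real.cos_neg, neg_sub, sub_neg_eq_add, add_comm]
    · rwa [← Real.cos_neg, neg_add, neg_neg, ← sub_eq_add_neg]
    · rwa [← Real.cos_neg, neg_add, neg_neg]

/-- After rotation by `e = e^(iγ)` the symbol, of modulus `r`, contributes at least `c r` to the
real part and `-z` at least `c`; the sum `c(1 + r)` controls `c(1+ξ²)^s`, which cancels the weight.
-/
theorem exists_symbol_coercive {s : ℝ} (hs : s ∈ Ioo (3 / 4 : ℝ) 1) {z : ℂ} (hz : z ≠ 0)
    (harg : (1 - s) * Real.pi < |z.arg|) :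
    ∃ e : ℂ, ‖e‖ = 1 ∧ ∃ c : ℝ, 0 < c ∧ ∀ ξ : ℝ,
      c ≤ (e * (-(fracSymbol s 1 ξ ^ 2) - z) * (bessel s ξ ^ 2 : ℝ)).re := by
  have hπ := Real.pi_pos
  obtain ⟨γ, c1, c2, c3⟩ := exists_separating_angle (κ := (1 - s) * Real.pi) (α := z.arg)
    (mul_pos (by linarith [hs.2]) hπ) (by nlinarith [hs.1]) harg (Complex.abs_arg_le_pi z)
  have hz' : 0 < -(‖z‖ * Real.cos (γ + z.arg)) := by
    have := norm_pos_iff.2 hz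
    nlinarith
  set c : ℝ := min (min (Real.cos (γ - (1 - s) * Real.pi)) (Real.cos (γ + (1 - s) * Real.pi)))
    (-(‖z‖ * Real.cos (γ + z.arg))) with hc
  have hc0 : 0 < c := lt_min (lt_min c1 c2) hz'
  refine ⟨Complex.exp (γ * Complex.I), Complex.norm_exp_ofReal_mul_I γ, c, hc0, fun ξ => ?_⟩
  obtain ⟨τ, hτ, hsq⟩ := fracSymbol_one_sq (s := s) (ξ := ξ) (by linarith [hs.1])
  set r : ℝ := (2 * Real.pi * |ξ|) ^ (2 * s) with hr
  have hr0 : 0 ≤ r := by positivity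
  have e1 : Complex.exp (γ * Complex.I) * (-(fracSymbol s 1 ξ ^ 2) - z) =
      -((r : ℂ) * Complex.exp ((γ + τ * (Real.pi * s) : ℝ) * Complex.I)) -
        (‖z‖ : ℂ) * Complex.exp ((γ + z.arg : ℝ) * Complex.I) := by
    conv_lhs => rw [← Complex.norm_mul_exp_arg_mul_I z]
    rw [hsq]
    push_cast
    rw [add_mul, add_mul, Complex.exp_add, Complex.exp_add]
    ring
  have e2 : (Complex.exp (γ * Complex.I) * (-(fracSymbol s 1 ξ ^ 2) - z)).re =
      r * -Real.cos (γ + τ * (Real.pi * s)) + -(‖z‖ * Real.cos (γ + z.arg)) := by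
    rw [e1, Complex.sub_re, Complex.neg_re, Complex.re_ofReal_mul, Complex.re_ofReal_mul,
      Complex.exp_ofReal_mul_I_re, Complex.exp_ofReal_mul_I_re]
    ring
  have e3 : c ≤ -Real.cos (γ + τ * (Real.pi * s)) := by
    rcases hτ with rfl | rfl
    · refine (min_le_left _ _).trans ((min_le_left _ _).trans (le_of_eq ?_))
      rw [← Real.cos_sub_pi]
      ring_nf
    · refine (min_le_left _ _).trans ((min_le_right _ _).trans (le_of_eq ?_))
      rw [← Real.cos_add_pi]
      ring_nf
  have e4 : c * (1 + ξ ^ 2) ^ s ≤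
      (Complex.exp (γ * Complex.I) * (-(fracSymbol s 1 ξ ^ 2) - z)).re := by
    -- Subadditivity of `t ↦ t^s` for `s ≤ 1`, together with `2π ≥ 1`.
    have h1 : (1 + ξ ^ 2) ^ s ≤ 1 + r := by
      refine (Real.rpow_add_le_add_rpow zero_le_one (sq_nonneg ξ) (by linarith [hs.1])
        hs.2.le).trans ?_
      rw [Real.one_rpow, hr, ← sq_abs, ← Real.rpow_natCast, ← Real.rpow_mul (abs_nonneg _)]
      push_cast
      gcongr 1 + ?_
      refine Real.rpow_le_rpow (abs_nonneg _) ?_ (by linarith [hs.1])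
      exact le_mul_of_one_le_left (abs_nonneg _) (by linarith [Real.pi_gt_three])
    rw [e2]
    calc c * (1 + ξ ^ 2) ^ s ≤ c * (1 + r) := by gcongr
      _ = r * c + c := by ring
      _ ≤ _ := by
        gcongr
        exact min_le_right _ _
  rw [Complex.re_mul_ofReal]
  calc c = c * (1 + ξ ^ 2) ^ s * bessel s ξ ^ 2 := by
        rw [mul_assoc, mul_comm _ (bessel s ξ ^ 2), bessel_sq, mul_one]
    _ ≤ _ := by gcongr

/-! ### The resolvent -/

/-- The abstract end of Lax–Milgram: `W` is the form domain, `ι` its map into `H`, and `N`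
represents the form of `A - z`. The hypothesis `hA` says `N w = ι*(Au - zu)` for `u = ι w`, so the
resolvent is `-ι N⁻¹ ι*`. -/
theorem mem_resolventSet_of_isUnit {H W : Type*} [NormedAddCommGroup H] [InnerProductSpace ℂ H]
    [CompleteSpace H] [NormedAddCommGroup W] [InnerProductSpace ℂ W] [CompleteSpace W]
    (A : H →ₗ.[ℂ] H) (z : ℂ) (ι : W →L[ℂ] H) {N : W →L[ℂ] W} (hN : IsUnit N)
    (hA : ∀ u f, (u, f) ∈ A.graph ↔
      ∃ w, ι w = u ∧ ∀ v, inner ℂ v (N w) = inner ℂ (ι v) (f - z • u)) :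
    z ∈ resolventSet A := by
  obtain ⟨N, rfl⟩ := hN
  have hr : ∀ w, (N : W →L[ℂ] W) ((↑N⁻¹ : W →L[ℂ] W) w) = w := fun w => by
    rw [← mul_apply_eq_comp, Units.mul_inv, one_apply_eq_self]
  have hl : ∀ w, (↑N⁻¹ : W →L[ℂ] W) ((N : W →L[ℂ] W) w) = w := fun w => by
    rw [← mul_apply_eq_comp, Units.inv_mul, one_apply_eq_self]
  refine ⟨-(ι ∘L (↑N⁻¹ : W →L[ℂ] W) ∘L ContinuousLinearMap.adjoint ι), fun f => ?_, fun u => ?_⟩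
  · set u := (-(ι ∘L (↑N⁻¹ : W →L[ℂ] W) ∘L ContinuousLinearMap.adjoint ι)) f with hu
    have hg : (u, z • u - f) ∈ A.graph := by
      rw [hA]
      refine ⟨-(↑N⁻¹ : W →L[ℂ] W) (ContinuousLinearMap.adjoint ι f), by simp [hu], fun v => ?_⟩
      rw [map_neg, hr, inner_neg_right, ContinuousLinearMap.adjoint_inner_right, ← inner_neg_right]
      congr 1
      abel
    have hd := LinearPMap.mem_domain_of_mem_graph hg
    refine ⟨hd, ?_⟩
    rw [← (LinearPMap.image_iff hd).2 hg]
    abel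
  · obtain ⟨w, hw, h⟩ := (hA _ _).1 (LinearPMap.mem_graph A u)
    have hNw : (N : W →L[ℂ] W) w = ContinuousLinearMap.adjoint ι (A u - z • (u : H)) := by
      refine ext_inner_left ℂ fun v => ?_
      rw [h v, ContinuousLinearMap.adjoint_inner_right]
    have : z • (u : H) - A u = -(A u - z • (u : H)) := by abel
    rw [this]
    simp only [neg_apply, ContinuousLinearMap.comp_apply, map_neg, neg_neg]
    rw [← hNw, hl, hw]

/-! ### The form domain on the Fourier side -/

/-- The function in `Hˢ(ℝ)` with weighted Fourier transform `w`. -/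
def besselInv {s : ℝ} (hs : 0 ≤ s) :
    Lp ℂ 2 (volume : Measure ℝ) →L[ℂ] Lp ℂ 2 (volume : Measure ℝ) :=
  ((Lp.fourierTransformₗᵢ ℝ ℂ).symm : Lp ℂ 2 (volume : Measure ℝ) →L[ℂ]
    Lp ℂ 2 (volume : Measure ℝ)) ∘L mulL (memLp_bessel hs)

theorem besselInv_apply {s : ℝ} (hs : 0 ≤ s) (w : Lp ℂ 2 (volume : Measure ℝ)) :
    besselInv hs w = 𝓕⁻ (mulL (memLp_bessel hs) w) := rfl

/-- The weighted Fourier transforms of the elements of `H̃ˢ(0,1)`. -/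
def besselSpace {s : ℝ} (hs : 0 ≤ s) : Submodule ℂ (Lp ℂ 2 (volume : Measure ℝ)) :=
  (LpToLpRestrictCLM ℝ ℂ ℂ volume 2 (Ioo (0 : ℝ) 1)ᶜ ∘L besselInv hs).ker

instance {s : ℝ} (hs : 0 ≤ s) : CompleteSpace (besselSpace hs) :=
  (ContinuousLinearMap.isClosed_ker _).completeSpace_coe

/-- The element of `L²(0,1)` with weighted Fourier transform `w`. -/
def ofBessel {s : ℝ} (hs : 0 ≤ s) : besselSpace hs →L[ℂ] L2I :=
  restrictL ∘L besselInv hs ∘L (besselSpace hs).subtypeL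

theorem mem_besselSpace_iff {s : ℝ} (hs : 0 ≤ s) (w : Lp ℂ 2 (volume : Measure ℝ)) :
    w ∈ besselSpace hs ↔ ∀ᵐ x, x ∉ Ioo (0 : ℝ) 1 → besselInv hs w x = 0 := by
  refine Iff.trans ?_ (ae_restrict_iff' measurableSet_Ioo.compl)
  change LpToLpRestrictCLM ℝ ℂ ℂ volume 2 (Ioo (0 : ℝ) 1)ᶜ (besselInv hs w) = 0 ↔ _
  rw [Lp.eq_zero_iff_ae_eq_zero]
  have h := LpToLpRestrictCLM_coeFn (p := 2) ℂ (Ioo (0 : ℝ) 1)ᶜ (besselInv hs w)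
  exact ⟨fun h' => h.symm.trans h', fun h' => h.trans h'⟩

theorem coeFn_zeroExt (u : L2I) : zeroExt u =ᵐ[volume] zeroExtFun u :=
  (memLp_zeroExt u).coeFn_toLp

theorem zeroExt_ofBessel {s : ℝ} (hs : 0 ≤ s) (w : besselSpace hs) :
    zeroExt (ofBessel hs w) = besselInv hs w := by
  refine Lp.ext ?_
  filter_upwards [coeFn_zeroExt (ofBessel hs w), (mem_besselSpace_iff hs w).1 w.2,
    (ae_restrict_iff' measurableSet_Ioo).1 (coeFn_restrictL (besselInv hs w))] with x h1 h2 h3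
  rw [h1]
  by_cases hx : x ∈ Ioo (0 : ℝ) 1
  · rw [zeroExtFun_of_mem _ hx, ← h3 hx]
    rfl
  · rw [zeroExtFun_of_notMem _ _ hx, h2 hx]

theorem mulL_bessel_eq {s : ℝ} (hs : 0 ≤ s) (w : besselSpace hs) :
    mulL (memLp_bessel hs) w = 𝓕 (zeroExt (ofBessel hs w)) := by
  rw [zeroExt_ofBessel, besselInv_apply, fourier_fourierInv_eq]

theorem restrictL_zeroExt (u : L2I) : restrictL (zeroExt u) = u := by
  refine Lp.ext ?_
  filter_upwards [coeFn_restrictL (zeroExt u), ae_restrict_of_ae (coeFn_zeroExt u),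
    ae_restrict_mem measurableSet_Ioo] with x h1 h2 hx
  rw [h1, h2, zeroExtFun_of_mem u hx]

/-- With `ofBessel_mem_Htilde` this identifies the range of `ofBessel` with `H̃ˢ`, so that
quantifiers over `H̃ˢ` pass to `besselSpace`. -/
theorem exists_ofBessel_eq {s : ℝ} (hs : 0 ≤ s) {u : L2I} (hu : u ∈ Htilde s) :
    ∃ w, ofBessel hs w = u := by
  obtain ⟨w, hw⟩ := (mem_Htilde_iff hs u).1 hu
  have h : besselInv hs w = zeroExt u := by
    rw [besselInv_apply, hw, fourierInv_fourier_eq]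
  refine ⟨⟨w, (mem_besselSpace_iff hs w).2 ?_⟩, ?_⟩
  · rw [h]
    filter_upwards [coeFn_zeroExt u] with x hx hm
    rw [hx, zeroExtFun_of_notMem u x hm]
  · change restrictL (besselInv hs w) = u
    rw [h, restrictL_zeroExt]

theorem ofBessel_mem_Htilde {s : ℝ} (hs : 0 ≤ s) (w : besselSpace hs) :
    ofBessel hs w ∈ Htilde s :=
  (mem_Htilde_iff hs _).2 ⟨w, mulL_bessel_eq hs w⟩

theorem inner_ofBessel {s : ℝ} (hs : 0 ≤ s) (v w : besselSpace hs) :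
    inner ℂ (ofBessel hs v) (ofBessel hs w) =
      inner ℂ (mulL (memLp_bessel hs) v) (mulL (memLp_bessel hs) w) := by
  have h : inner ℂ (ofBessel hs v) (ofBessel hs w) = inner ℂ (besselInv hs v) (besselInv hs w) := by
    refine inner_restrictL_of_ae ?_
    filter_upwards [(mem_besselSpace_iff hs v).1 v.2] with x hx hm
    exact Or.inl (hx hm)
  rw [h]
  exact (Lp.fourierTransformₗᵢ ℝ ℂ).symm.inner_map_map _ _

/-- The bounded operator on `besselSpace` that represents the form of `A - z`. -/
def shiftedForm {s : ℝ} (hs : 0 ≤ s) (z : ℂ) : besselSpace hs →L[ℂ] besselSpace hs :=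
  ContinuousLinearMap.adjoint (besselSpace hs).subtypeL ∘L
    (-(ContinuousLinearMap.adjoint (mulL (memLp_fracSymbol_mul_bessel hs (Or.inr rfl))) ∘L
        mulL (memLp_fracSymbol_mul_bessel hs (Or.inl rfl))) -
      z • (ContinuousLinearMap.adjoint (mulL (memLp_bessel hs)) ∘L mulL (memLp_bessel hs))) ∘L
    (besselSpace hs).subtypeL

theorem inner_shiftedForm {s : ℝ} (hs : 0 ≤ s) (z : ℂ) (v w : besselSpace hs) :
    inner ℂ v (shiftedForm hs z w) =
      -inner ℂ (mulL (memLp_fracSymbol_mul_bessel hs (Or.inr rfl)) v)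
        (mulL (memLp_fracSymbol_mul_bessel hs (Or.inl rfl)) w) -
      z * inner ℂ (mulL (memLp_bessel hs) v) (mulL (memLp_bessel hs) w) := by
  simp only [shiftedForm, ContinuousLinearMap.comp_apply]
  rw [ContinuousLinearMap.adjoint_inner_right]
  simp only [sub_apply, neg_apply, smul_apply, ContinuousLinearMap.comp_apply,
    Submodule.subtypeL_apply, inner_sub_right, inner_neg_right, inner_smul_right,
    ContinuousLinearMap.adjoint_inner_right]

theorem integrable_mul_norm_sq {m : ℝ → ℂ} (hm : MemLp m ⊤ (volume : Measure ℝ))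
    (w : Lp ℂ 2 (volume : Measure ℝ)) : Integrable fun ξ => m ξ * (w ξ * starRingEnd ℂ (w ξ)) := by
  refine (MeasureTheory.L2.integrable_inner (𝕜 := ℂ) w (mulL hm w)).congr ?_
  filter_upwards [coeFn_mulL hm w] with ξ h
  rw [h]
  simp
  ring

/-- On the diagonal the form is the symbol of `A - z` integrated against a nonnegative density, so
pointwise lower bounds for the symbol carry over. -/
theorem inner_shiftedForm_self {s : ℝ} (hs : 0 ≤ s) (z : ℂ) (w : besselSpace hs) :
    Integrable (fun ξ => (-(fracSymbol s 1 ξ ^ 2) - z) * (bessel s ξ ^ 2 : ℝ) *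
      ((‖(w : Lp ℂ 2 (volume : Measure ℝ)) ξ‖ ^ 2 : ℝ) : ℂ)) ∧
    inner ℂ w (shiftedForm hs z w) = ∫ ξ, (-(fracSymbol s 1 ξ ^ 2) - z) * (bessel s ξ ^ 2 : ℝ) *
      ((‖(w : Lp ℂ 2 (volume : Measure ℝ)) ξ‖ ^ 2 : ℝ) : ℂ) := by
  have ha := (memLp_fracSymbol_mul_bessel (s := s) (σ := 1) hs (Or.inl rfl))
  have hp := memLp_bessel hs
  have i1 := integrable_mul_norm_sq (ha.mul' ha (r := ⊤)) w
  have i2 := (integrable_mul_norm_sq (hp.mul' hp (r := ⊤)) w).const_mul z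
  have key : ∀ ξ, (-(fracSymbol s 1 ξ ^ 2) - z) * (bessel s ξ ^ 2 : ℝ) *
      ((‖(w : Lp ℂ 2 (volume : Measure ℝ)) ξ‖ ^ 2 : ℝ) : ℂ) =
      -((fracSymbol s 1 ξ * bessel s ξ) * (fracSymbol s 1 ξ * bessel s ξ) *
        ((w : Lp ℂ 2 (volume : Measure ℝ)) ξ *
          starRingEnd ℂ ((w : Lp ℂ 2 (volume : Measure ℝ)) ξ))) -
      z * ((bessel s ξ : ℂ) * bessel s ξ * ((w : Lp ℂ 2 (volume : Measure ℝ)) ξ *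
          starRingEnd ℂ ((w : Lp ℂ 2 (volume : Measure ℝ)) ξ))) := by
    intro ξ
    rw [Complex.mul_conj, Complex.normSq_eq_norm_sq]
    push_cast
    ring
  simp only [key]
  refine ⟨i1.fun_neg.sub i2, ?_⟩
  rw [integral_sub i1.fun_neg i2, integral_neg, integral_const_mul, inner_shiftedForm,
    inner_mulL_mulL, inner_mulL_mulL]
  simp only [map_mul, star_fracSymbol_neg_one, Complex.conj_ofReal]

/-- Multiplication by the unimodular `e` does not change `|⟪w, Nw⟫|`, so a lower bound for the real
part of the rotated form is enough. -/
theorem isUnit_shiftedForm {s : ℝ} (hs : s ∈ Ioo (3 / 4 : ℝ) 1) (hs0 : 0 ≤ s) {z : ℂ} (hz : z ≠ 0)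
    (harg : (1 - s) * Real.pi < |z.arg|) : IsUnit (shiftedForm hs0 z) := by
  obtain ⟨e, he, c, hc, h⟩ := exists_symbol_coercive hs hz harg
  refine ContinuousLinearMap.isUnit_of_forall_le_norm_inner_map _ (c := ⟨c, hc.le⟩) hc fun w => ?_
  obtain ⟨hi, hw⟩ := inner_shiftedForm_self hs0 z w
  have hn : ‖w‖ ^ 2 = ∫ ξ, ‖(w : Lp ℂ 2 (volume : Measure ℝ)) ξ‖ ^ 2 := by
    have h1 := MeasureTheory.L2.inner_def (𝕜 := ℂ) (w : Lp ℂ 2 (volume : Measure ℝ)) w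
    rw [inner_self_eq_norm_sq_to_K] at h1
    simp only [inner_self_eq_norm_sq_to_K] at h1
    norm_cast at h1
  have hsq : Integrable fun ξ => ‖(w : Lp ℂ 2 (volume : Measure ℝ)) ξ‖ ^ 2 :=
    (Lp.memLp (w : Lp ℂ 2 (volume : Measure ℝ))).integrable_norm_pow (by norm_num)
  rw [norm_inner_symm, hw]
  calc ‖w‖ ^ 2 * c = ∫ ξ, c * ‖(w : Lp ℂ 2 (volume : Measure ℝ)) ξ‖ ^ 2 := by
        rw [integral_const_mul, hn, mul_comm]
    _ ≤ ∫ ξ, (e * ((-(fracSymbol s 1 ξ ^ 2) - z) * (bessel s ξ ^ 2 : ℝ) *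
          ((‖(w : Lp ℂ 2 (volume : Measure ℝ)) ξ‖ ^ 2 : ℝ) : ℂ))).re := by
        refine integral_mono (hsq.const_mul c) (hi.const_mul e).re fun ξ => ?_
        change _ ≤ (e * _).re
        rw [← mul_assoc, ← mul_assoc, Complex.re_mul_ofReal]
        exact mul_le_mul_of_nonneg_right (h ξ) (by positivity)
    _ = (e * ∫ ξ, (-(fracSymbol s 1 ξ ^ 2) - z) * (bessel s ξ ^ 2 : ℝ) *
          ((‖(w : Lp ℂ 2 (volume : Measure ℝ)) ξ‖ ^ 2 : ℝ) : ℂ)).re := by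
        rw [← integral_const_mul]
        exact integral_re (hi.const_mul e)
    _ ≤ _ := by
        refine (Complex.re_le_norm _).trans ?_
        rw [norm_mul, he, one_mul]

/-- This is the hypothesis `hA` of `mem_resolventSet_of_isUnit`. The terms with `z` cancel, leaving
the defining identity of `A`. -/
theorem mem_graph_operator_iff {β : ℝ} (hs : β / 2 ∈ Ioo (0 : ℝ) 1)
    {hL : Htilde (β / 2) ≤ (leftRL (β / 2)).domain}
    {hR : Htilde (β / 2) ≤ (rightRL (β / 2)).domain} (z : ℂ) (u f : L2I) :
    (u, f) ∈ (operator β hL hR).graph ↔ ∃ w, ofBessel hs.1.le w = u ∧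
      ∀ v, inner ℂ v (shiftedForm hs.1.le z w) = inner ℂ (ofBessel hs.1.le v) (f - z • u) := by
  have hform : ∀ v w : besselSpace hs.1.le,
      inner ℂ v (shiftedForm hs.1.le z w) =
        form β hL hR ⟨_, ofBessel_mem_Htilde hs.1.le w⟩ ⟨_, ofBessel_mem_Htilde hs.1.le v⟩ -
        z * inner ℂ (ofBessel hs.1.le v) (ofBessel hs.1.le w) := fun v w => by
    rw [inner_shiftedForm, inner_ofBessel, form_eq hs _ _ (mulL_bessel_eq hs.1.le w)
      (mulL_bessel_eq hs.1.le v)]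
  rw [graph_operator]
  constructor
  · rintro ⟨φ, hφ, h⟩
    obtain ⟨w, hw⟩ := exists_ofBessel_eq hs.1.le φ.2
    refine ⟨w, hw.trans hφ, fun v => ?_⟩
    have hφ' : (⟨_, ofBessel_mem_Htilde hs.1.le w⟩ : Htilde (β / 2)) = φ := Subtype.ext hw
    rw [hform, hφ', h, hw, hφ, inner_sub_right, inner_smul_right]
  · rintro ⟨w, hw, h⟩
    refine ⟨⟨_, ofBessel_mem_Htilde hs.1.le w⟩, hw, fun ψ => ?_⟩
    obtain ⟨v, hv⟩ := exists_ofBessel_eq hs.1.le ψ.2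
    have hψ' : (⟨_, ofBessel_mem_Htilde hs.1.le v⟩ : Htilde (β / 2)) = ψ := Subtype.ext hv
    have h1 := h v
    rw [← hw, hform, hψ', hv, inner_sub_right, inner_smul_right] at h1
    exact sub_left_inj.1 h1

end FracOp

end

/-! ### The sector in the resolvent set. -/

theorem mainTheorem9 (β : ℝ) (hβ : β ∈ Set.Ioo (3 / 2 : ℝ) 2) :
    ∃ (hL : FracOp.Htilde (β / 2) ≤ (FracOp.leftRL (β / 2)).domain)
      (hR : FracOp.Htilde (β / 2) ≤ (FracOp.rightRL (β / 2)).domain),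
      ∀ θ ∈ Set.Ioo ((2 - β) * Real.pi / 2) (Real.pi / 4),
        {z : ℂ | z ≠ 0 ∧ θ ≤ |z.arg| ∧ |z.arg| ≤ Real.pi} ⊆
          FracOp.resolventSet (FracOp.operator β hL hR) := by
  have hs : β / 2 ∈ Set.Ioo (3 / 4 : ℝ) 1 := ⟨by linarith [hβ.1], by linarith [hβ.2]⟩
  have hs' : β / 2 ∈ Set.Ioo (0 : ℝ) 1 := ⟨by linarith [hs.1], hs.2⟩
  refine ⟨FracOp.Htilde_le_domain_leftRL hs', FracOp.Htilde_le_domain_rightRL hs', ?_⟩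
  rintro θ hθ z ⟨hz, harg, -⟩
  refine FracOp.mem_resolventSet_of_isUnit _ z (FracOp.ofBessel hs'.1.le)
    (FracOp.isUnit_shiftedForm hs hs'.1.le hz ?_) (FracOp.mem_graph_operator_iff hs' z)
  -- `(1 - β/2)π = (2-β)π/2 < θ ≤ |arg z|`.
  linarith [hθ.1]
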